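/- Let $(\varepsilon_k)_{k\in\mathbb Z}$ be the coordinate maps on $\Omega=\{0,1\}^{\mathbb Z}$, let $\mu$ be the product probability measure under which they are i.i.d. with $\mu\{\varepsilon_k=0\}=\mu\{\varepsilon_k=1\}=1/2$, let $T:\Omega\to\Omega$ be the two-sided shift, $\varepsilon_k\circ T=\varepsilon_{k+1}$, and put $X=\sum_{k\ge 0}2^{-k-1}\varepsilon_{-k}$, a random variable uniformly distributed on $[0,1]$, so that $X\circ T^n=\sum_{k\ge 0}2^{-k-1}\varepsilon_{n-k}$ for $n\ge 0$. Let $1<p<r<2$, and let $f:[0,1]\to\mathbb R$ belong to $\mathbb L^r$ with respect to Lebesgue measure and satisfy $\int_0^1 f(x)\,dx=0$. Put $q=\max\{1,(p-1)r/(r-1)\}$ and $\tilde f(x)=f(x)-\tfrac12 f(x/2)-\tfrac12 f((x+1)/2)$ for $x\in[0,1]$. Assume that for some $\delta>0$ $$\int_0^1\!\int_0^1\frac{|f(x)-f(y)|^q}{|x-y|}\Bigl(\log\frac1{|x-y|}\Bigr)^{q-1+\delta}dx\,dy<\infty \quad\text{and}\quad \int_0^1\!\int_0^1\frac{|\tilde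 f(x)-\tilde f(y)|^r}{|x-y|}\Bigl(\log\frac1{|x-y|}\Bigr)^{r-1+\delta}dx\,dy<\infty .$$ Then $f$ satisfies the $p$-strong law of large numbers: with $S_k(f)=\sum_{j=0}^{k-1}f(X\circ T^j)$, for every $\alpha\in[1/p,1]$ and every $\varepsilon>0$, $$\sum_{n=1}^{\infty}n^{\alpha p-2}\,\mu\Bigl\{\max_{1\le k\le n}|S_k(f)|\ge\varepsilon n^{\alpha}\Bigr\}<\infty .$$ -/

import Mathlib

open MeasureTheory

noncomputable section

/-- The function `F : Ω → ℝ` satisfies the `p`-strong law of large numbers for the dynamical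
system `(Ω, μ, T)`: for every `α ∈ [1/p, 1]` and every `ε > 0`,
`∑_{n ≥ 1} n ^ (α p - 2) μ {max_{1 ≤ k ≤ n} |S_k(F)| ≥ ε n ^ α} < ∞`, where
`S_k(F) = ∑_{j < k} F ∘ T ^ j` is the Birkhoff sum.
The maximum over the finite set `{1, …, n}` is at least `c` iff one of its members is; for `n = 0`
the event below is empty, so that this term of the series is zero. -/
def PStrongLaw {Ω : Type*} [MeasurableSpace Ω] (μ : Measure Ω) (T : Ω → Ω) (p : ℝ)
    (F : Ω → ℝ) : Prop :=
  ∀ α : ℝ, 1 / p ≤ α → α ≤ 1 → ∀ ε : ℝ, 0 < ε →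
    Summable fun n : ℕ =>
      (n : ℝ) ^ (α * p - 2) *
        μ.real {ω | ∃ k : ℕ, 1 ≤ k ∧ k ≤ n ∧ ε * (n : ℝ) ^ α ≤ |birkhoffSum T F k ω|}

/-- Two-sided sequences of binary digits; `ω k` is the value of `ε_k`. -/
abbrev CoinSpace : Type := ℤ → Fin 2

/-- The law under which the coordinates `ε_k` are i.i.d., equal to `0` or `1` with probability
`1/2` each. -/
def coinMeasure : Measure CoinSpace :=
  Measure.infinitePi fun _ : ℤ => (PMF.uniformOfFintype (Fin 2)).toMeasure

/-- The two-sided Bernoulli shift, `ε_k ∘ T = ε_{k+1}`. -/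
def coinShift (ω : CoinSpace) : CoinSpace := fun k => ω (k + 1)

/-- The point `x = ∑_{k ≥ 0} 2 ^ (-k-1) ε_{-k}` of `[0, 1]`. -/
def dyadicPoint (ω : CoinSpace) : ℝ :=
  ∑' k : ℕ, ((ω (-(k : ℤ)) : ℕ) : ℝ) / 2 ^ (k + 1)

/-- `∫_0^1 ∫_0^1 |h x - h y| ^ s / |x - y| * (log (1 / |x - y|)) ^ (s - 1 + δ) dx dy < ∞`. -/
def LogWeightedIntegralFinite (h : ℝ → ℝ) (s δ : ℝ) : Prop :=
  ∫⁻ x in Set.Icc (0 : ℝ) 1, ∫⁻ y in Set.Icc (0 : ℝ) 1,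
    ENNReal.ofReal
      (|h x - h y| ^ s / |x - y| * Real.log (1 / |x - y|) ^ (s - 1 + δ)) < ⊤

/-- `f̃ x = f x - f (x / 2) / 2 - f ((x + 1) / 2) / 2`. -/
def dyadicTilde (f : ℝ → ℝ) (x : ℝ) : ℝ :=
  f x - f (x / 2) / 2 - f ((x + 1) / 2) / 2

end

/-!
The chain `X_n = X ∘ T ^ n` satisfies `X_{n+1} = (X_n + ε_{n+1}) / 2` with `X_n` uniform on the unit
interval, so that `X_n` is recovered from `X_{n+1}` by the doubling map `D x = 2 x mod 1`. Read
backwards, a block of the chain is therefore an orbit of `D` started from a uniform point, and the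
whole statement becomes one about Lebesgue measure on the unit interval, the doubling map and its
transfer operator `P f x = (f (x / 2) + f ((x + 1) / 2)) / 2`, the adjoint of composition with `D`.
No conditional expectations are needed: "reversed martingale difference" just means `P d = 0`.

*Decay.* `‖P ^ n f‖_q ^ q` is at most `2 ^ n` times the integral of `|f x - f y| ^ q` over the strip
`|x - y| ≤ 2 ^ (-n)`. Summing over `n < m ≤ 2 n` and using that the norms decrease, the logarithmic
integral condition on `f` gives `‖P ^ n f‖_q = O(n ^ (-1 - δ / q))`
(`exists_lintegral_branchAverage_le`). Interpolating with the boundedness in `L^r`, one finds an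
exponent `s` in `(p, r)` with `‖P ^ n f‖_s = O(n ^ (-1 + 1 / s))`; the strict inequality `p < s` is
paid for by `δ > 0` (`exists_interpolation_exponent`).

*Moments.* For `h` in `L^s`, `h + h ∘ D = (h - P h ∘ D) + (h + P h) ∘ D`. The first bracket is a
reversed martingale difference, whose orbit sums obey a von Bahr–Esseen inequality
(`eLpNorm_orbitSum_le`); the second starts the same decomposition for `h + P h` at twice the time
scale. Iterating over all dyadic scales, the rate above gives
`‖∑_{j < 2 ^ l} f ∘ D ^ j‖_s = O(l ^ 2 2 ^ (l / s))` (`eLpNorm_orbitSum_two_pow_le`).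

*Conclusion.* Dyadic chaining bounds the probability that `max_{k ≤ n} |S_k|` reaches `a` by
`n a ^ (-s)`, up to a power of `log n` (`measureReal_exists_le_abs_sum_le`), and as `s > p` the
series converges for every `α ≥ 1 / p` (`summable_of_tail_le`).
-/

/-! ### Averaging over the inverse branches of `x ↦ N x mod 1` -/

/-- Lebesgue measure on the unit interval. The right endpoint is left out, so that
`x ↦ N x mod 1` maps the interval to itself. -/
noncomputable def unitLaw : Measure ℝ := volume.restrict (Set.Ico (0 : ℝ) 1)

/-- The transfer operator of `x ↦ N x mod 1`: the mean of `f` over the `N` preimages of `x`.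
For `N = 2 ^ n` it is the `n`-step transition operator of the chain of dyadic points. -/
noncomputable def branchAverage (N : ℕ) (f : ℝ → ℝ) (x : ℝ) : ℝ :=
  (N : ℝ)⁻¹ * ∑ j ∈ Finset.range N, f ((x + j) / N)

/-- The map `x ↦ N x mod 1`. -/
noncomputable def mulMod (N : ℕ) (x : ℝ) : ℝ := Int.fract (N * x)

instance : IsProbabilityMeasure unitLaw := ⟨by simp [unitLaw]⟩

lemma ae_unitLaw_mem : ∀ᵐ x ∂unitLaw, x ∈ Set.Ico (0 : ℝ) 1 :=
  ae_restrict_mem measurableSet_Ico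

lemma unitLaw_eq_restrict_Icc : unitLaw = volume.restrict (Set.Icc (0 : ℝ) 1) :=
  Measure.restrict_congr_set Ico_ae_eq_Icc

@[fun_prop]
lemma measurable_mulMod (N : ℕ) : Measurable (mulMod N) := by
  unfold mulMod; fun_prop

@[fun_prop]
lemma measurable_branchAverage (N : ℕ) {f : ℝ → ℝ} (hf : Measurable f) :
    Measurable (branchAverage N f) := by
  unfold branchAverage; fun_prop

lemma map_branch_unitLaw {N : ℕ} (hN : 0 < N) (j : ℕ) :
    unitLaw.map (fun x : ℝ => (x + j) / N) =
      (N : ENNReal) • volume.restrict (Set.Ico ((j : ℝ) / N) ((j + 1 : ℕ) / N)) := by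
  have hN' : (0 : ℝ) < N := by exact_mod_cast hN
  have hpre : (fun x : ℝ => (x + j) / N) ⁻¹' Set.Ico ((j : ℝ) / N) ((j + 1 : ℕ) / N)
      = Set.Ico 0 1 := by
    ext x
    simp only [Set.mem_preimage, Set.mem_Ico, div_le_div_iff_of_pos_right hN',
      div_lt_div_iff_of_pos_right hN']
    push_cast
    constructor <;> rintro ⟨h1, h2⟩ <;> constructor <;> linarith
  have hvol : (volume : Measure ℝ).map (fun x : ℝ => (x + j) / N) = (N : ENNReal) • volume := by
    have h1 : (fun x : ℝ => (x + j) / N) = (fun x => (N : ℝ)⁻¹ * x) ∘ fun x => x + j := by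
      ext x; simp [div_eq_inv_mul]
    rw [h1, ← Measure.map_map (by fun_prop) (by fun_prop), map_add_right_eq_self,
      Real.map_volume_mul_left (inv_ne_zero hN'.ne')]
    simp
  rw [unitLaw, ← hpre, ← Measure.restrict_map (by fun_prop) measurableSet_Ico, hvol,
    Measure.restrict_smul]

lemma sum_restrict_Ico_div {N : ℕ} (hN : 0 < N) (k : ℕ) :
    ∑ j ∈ Finset.range k, (volume : Measure ℝ).restrict (Set.Ico ((j : ℝ) / N) ((j + 1 : ℕ) / N))
      = volume.restrict (Set.Ico 0 ((k : ℝ) / N)) := by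
  have hN' : (0 : ℝ) < N := by exact_mod_cast hN
  induction k with
  | zero => simp
  | succ k ih =>
    rw [Finset.sum_range_succ, ih, ← Measure.restrict_union _ measurableSet_Ico,
      Set.Ico_union_Ico_eq_Ico (by positivity)]
    · gcongr; exact_mod_cast k.le_succ
    · rw [Set.disjoint_left]
      exact fun x hx hx' => absurd hx.2 (not_lt.2 hx'.1)

/-- Lebesgue measure on the unit interval is the mean of its images under the `N` inverse branches
of `x ↦ N x mod 1`. -/
lemma unitLaw_eq_sum_map {N : ℕ} (hN : 0 < N) :
    unitLaw = (N : ENNReal)⁻¹ •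
      ∑ j ∈ Finset.range N, unitLaw.map (fun x : ℝ => (x + j) / N) := by
  have hN' : (N : ℝ) ≠ 0 := by exact_mod_cast hN.ne'
  simp_rw [map_branch_unitLaw hN]
  rw [← Finset.smul_sum, sum_restrict_Ico_div hN, smul_smul,
    ENNReal.inv_mul_cancel (by exact_mod_cast hN.ne') (ENNReal.natCast_ne_top N), one_smul,
    div_self hN']
  rfl

lemma lintegral_unitLaw_eq_sum {N : ℕ} (hN : 0 < N) {g : ℝ → ENNReal} (hg : Measurable g) :
    ∫⁻ x, g x ∂unitLaw =
      (N : ENNReal)⁻¹ * ∑ j ∈ Finset.range N, ∫⁻ x, g ((x + j) / N) ∂unitLaw := by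
  conv_lhs => rw [unitLaw_eq_sum_map hN]
  rw [lintegral_smul_measure, lintegral_finsetSum_measure, smul_eq_mul]
  congr 1
  refine Finset.sum_congr rfl fun j _ => ?_
  rw [lintegral_map hg (by fun_prop)]

lemma integrable_comp_branch {N : ℕ} (hN : 0 < N) {f : ℝ → ℝ} (hf : Integrable f unitLaw) {j : ℕ}
    (hj : j < N) : Integrable f (unitLaw.map (fun x : ℝ => (x + j) / N)) := by
  have h := hf
  rw [unitLaw_eq_sum_map hN, integrable_smul_measure (by simp) (by simp [hN.ne'])] at h
  exact h.mono_measure (Finset.single_le_sum (f := fun j : ℕ =>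
    unitLaw.map (fun x : ℝ => (x + j) / N)) (fun _ _ => Measure.zero_le _) (Finset.mem_range.2 hj))

lemma integral_branchAverage {N : ℕ} (hN : 0 < N) {f : ℝ → ℝ} (hf : Measurable f)
    (hfi : Integrable f unitLaw) : ∫ x, branchAverage N f x ∂unitLaw = ∫ x, f x ∂unitLaw := by
  have hi : ∀ j ∈ Finset.range N, Integrable f (unitLaw.map (fun x : ℝ => (x + j) / N)) :=
    fun j hj => integrable_comp_branch hN hfi (Finset.mem_range.1 hj)
  conv_rhs => rw [unitLaw_eq_sum_map hN]
  rw [integral_smul_measure, integral_finsetSum_measure hi]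
  unfold branchAverage
  rw [integral_const_mul, integral_finsetSum]
  · simp only [ENNReal.toReal_inv, ENNReal.toReal_natCast, smul_eq_mul]
    congr 1
    refine Finset.sum_congr rfl fun j _ => ?_
    rw [integral_map (by fun_prop) hf.aestronglyMeasurable]
  · intro j hj
    exact (integrable_map_measure hf.aestronglyMeasurable (by fun_prop)).1 (hi j hj)

lemma mulMod_branch {N : ℕ} (hN : 0 < N) (j : ℕ) {x : ℝ} (hx : x ∈ Set.Ico (0 : ℝ) 1) :
    mulMod N ((x + j) / N) = x := by
  have hN' : (N : ℝ) ≠ 0 := by exact_mod_cast hN.ne'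
  rw [mulMod, mul_div_cancel₀ _ hN', Int.fract_add_natCast, Int.fract_eq_self.2 hx]

lemma mulMod_mulMod (M N : ℕ) (x : ℝ) : mulMod M (mulMod N x) = mulMod (M * N) x := by
  simp only [mulMod]
  rw [Int.fract_eq_fract]
  refine ⟨-(M * ⌊(N : ℝ) * x⌋), ?_⟩
  push_cast
  rw [Int.fract]
  ring

lemma measurePreserving_mulMod {N : ℕ} (hN : 0 < N) :
    MeasurePreserving (mulMod N) unitLaw unitLaw := by
  refine ⟨by fun_prop, ?_⟩
  ext s hs
  rw [Measure.map_apply (by fun_prop) hs, ← lintegral_indicator_one (measurable_mulMod N hs),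
    lintegral_unitLaw_eq_sum hN (by measurability)]
  have : ∀ j ∈ Finset.range N, ∫⁻ x, (mulMod N ⁻¹' s).indicator 1 ((x + j) / N) ∂unitLaw
      = unitLaw s := by
    intro j _
    rw [← lintegral_indicator_one hs]
    refine lintegral_congr_ae ?_
    filter_upwards [ae_unitLaw_mem] with x hx
    by_cases h : x ∈ s <;> simp [Set.indicator, mulMod_branch hN j hx, h]
  rw [Finset.sum_congr rfl this, Finset.sum_const, Finset.card_range, nsmul_eq_mul, ← mul_assoc,
    ENNReal.inv_mul_cancel (by exact_mod_cast hN.ne') (ENNReal.natCast_ne_top N), one_mul]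

lemma branchAverage_branchAverage {M N : ℕ} (hM : 0 < M) (hN : 0 < N) (f : ℝ → ℝ) :
    branchAverage M (branchAverage N f) = branchAverage (M * N) f := by
  have hN' : (N : ℝ) ≠ 0 := by exact_mod_cast hN.ne'
  have hM' : (M : ℝ) ≠ 0 := by exact_mod_cast hM.ne'
  ext x
  simp only [branchAverage]
  rw [← Finset.mul_sum, ← mul_assoc, Nat.cast_mul, mul_inv]
  congr 1
  have key : ∀ n : ℕ, ∑ k ∈ Finset.range (n * M), f ((x + k) / (M * N)) =
      ∑ i ∈ Finset.range n, ∑ j ∈ Finset.range M, f ((x + (i * M + j : ℕ)) / (M * N)) := by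
    intro n
    induction n with
    | zero => simp
    | succ n ih => rw [Nat.succ_mul, Finset.sum_range_add, ih, Finset.sum_range_succ]
  rw [mul_comm M N, key, Finset.sum_comm]
  refine Finset.sum_congr rfl fun i _ => Finset.sum_congr rfl fun j _ => ?_
  congr 1
  push_cast
  field_simp
  ring

lemma branchAverage_one (f : ℝ → ℝ) : branchAverage 1 f = f := by
  ext x; simp [branchAverage]

/-- `branchAverage N` and composition with `x ↦ N x mod 1` are adjoint to each other; this is the
pointwise form. -/
lemma branchAverage_mul_comp_mulMod {N : ℕ} (hN : 0 < N) (φ ψ : ℝ → ℝ) {x : ℝ}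
    (hx : x ∈ Set.Ico (0 : ℝ) 1) :
    branchAverage N (fun y => ψ (mulMod N y) * φ y) x = ψ x * branchAverage N φ x := by
  simp only [branchAverage, mulMod_branch hN _ hx, ← Finset.mul_sum]
  ring

/-- If `φ` has vanishing means over the inverse branches, it is orthogonal to every function of
`N x mod 1`. -/
lemma integral_comp_mulMod_mul_eq_zero {N : ℕ} (hN : 0 < N) {φ ψ : ℝ → ℝ} (hφ : Measurable φ)
    (hψ : Measurable ψ) (hi : Integrable (fun y => ψ (mulMod N y) * φ y) unitLaw)
    (h0 : ∀ x ∈ Set.Ico (0 : ℝ) 1, branchAverage N φ x = 0) :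
    ∫ y, ψ (mulMod N y) * φ y ∂unitLaw = 0 := by
  rw [← integral_branchAverage hN (by fun_prop) hi]
  refine integral_eq_zero_of_ae ?_
  filter_upwards [ae_unitLaw_mem] with x hx
  rw [branchAverage_mul_comp_mulMod hN φ ψ hx, h0 x hx, mul_zero]
  rfl

lemma enorm_mean_rpow_le {N : ℕ} (hN : 0 < N) (c : ℕ → ℝ) {s : ℝ} (hs : 1 ≤ s) :
    ‖(N : ℝ)⁻¹ * ∑ j ∈ Finset.range N, c j‖ₑ ^ s ≤
      (N : ENNReal)⁻¹ * ∑ j ∈ Finset.range N, ‖c j‖ₑ ^ s := by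
  have h0 : (N : ENNReal) ≠ 0 := by exact_mod_cast hN.ne'
  have h1 : ‖(N : ℝ)⁻¹ * ∑ j ∈ Finset.range N, c j‖ₑ ≤
      ∑ j ∈ Finset.range N, (N : ENNReal)⁻¹ * ‖c j‖ₑ := by
    rw [enorm_mul, ← Finset.mul_sum, enorm_inv (by exact_mod_cast hN.ne')]
    have : ‖(N : ℝ)‖ₑ = N := by simp
    rw [this]
    gcongr
    exact enorm_sum_le _ _
  refine (ENNReal.rpow_le_rpow h1 (by linarith)).trans ?_
  rw [Finset.mul_sum]
  refine ENNReal.rpow_arith_mean_le_arith_mean_rpow _ _ _ ?_ hs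
  rw [Finset.sum_const, Finset.card_range, nsmul_eq_mul,
    ENNReal.mul_inv_cancel h0 (ENNReal.natCast_ne_top N)]

lemma lintegral_branchAverage_rpow_le {N : ℕ} (hN : 0 < N) {f : ℝ → ℝ} (hf : Measurable f) {s : ℝ}
    (hs : 1 ≤ s) :
    ∫⁻ x, ‖branchAverage N f x‖ₑ ^ s ∂unitLaw ≤ ∫⁻ x, ‖f x‖ₑ ^ s ∂unitLaw := by
  rw [lintegral_unitLaw_eq_sum (g := fun x => ‖f x‖ₑ ^ s) hN (by fun_prop),
    ← lintegral_finsetSum _ (by fun_prop), ← lintegral_const_mul _ (by fun_prop)]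
  exact lintegral_mono fun x => enorm_mean_rpow_le hN _ hs

/-! ### Decay of the averages of a function with a logarithmic modulus of continuity -/

/-- `|f x - f y| ^ q` on the strip `|x - y| ≤ 1 / N`, extended by zero. -/
noncomputable def stripDiff (f : ℝ → ℝ) (q : ℝ) (N : ℕ) : ℝ × ℝ → ENNReal :=
  {z : ℝ × ℝ | |z.1 - z.2| ≤ 1 / N}.indicator fun z => ‖f z.1 - f z.2‖ₑ ^ q

@[fun_prop]
lemma measurable_stripDiff {f : ℝ → ℝ} (hf : Measurable f) (q : ℝ) (N : ℕ) :
    Measurable (stripDiff f q N) := by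
  unfold stripDiff
  refine Measurable.indicator (by fun_prop) ?_
  exact measurableSet_le (by fun_prop) (by fun_prop)

lemma enorm_integral_rpow_le {g : ℝ → ℝ} (hg : Measurable g) {q : ℝ} (hq : 1 ≤ q) :
    ‖∫ y, g y ∂unitLaw‖ₑ ^ q ≤ ∫⁻ y, ‖g y‖ₑ ^ q ∂unitLaw := by
  have hq0 : 0 < q := by linarith
  have h := eLpNorm'_le_eLpNorm'_of_exponent_le one_pos hq (μ := unitLaw)
    hg.aestronglyMeasurable
  have h1 : ‖∫ y, g y ∂unitLaw‖ₑ ≤ eLpNorm' g 1 unitLaw := by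
    simpa [eLpNorm'] using enorm_integral_le_lintegral_enorm (μ := unitLaw) g
  calc ‖∫ y, g y ∂unitLaw‖ₑ ^ q ≤ (eLpNorm' g q unitLaw) ^ q :=
        ENNReal.rpow_le_rpow (h1.trans h) hq0.le
    _ = _ := (lintegral_rpow_enorm_eq_rpow_eLpNorm' hq0).symm

/-- A centred function is averaged out by the `N` inverse branches up to its oscillation at
scale `1 / N`. -/
lemma lintegral_branchAverage_rpow_le_stripDiff {N : ℕ} (hN : 0 < N) {f : ℝ → ℝ}
    (hf : Measurable f) (hfi : Integrable f unitLaw) (hf0 : ∫ x, f x ∂unitLaw = 0) {q : ℝ}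
    (hq : 1 ≤ q) :
    ∫⁻ x, ‖branchAverage N f x‖ₑ ^ q ∂unitLaw ≤
      N * ∫⁻ x, ∫⁻ y, stripDiff f q N (x, y) ∂unitLaw ∂unitLaw := by
  have hN0 : (N : ENNReal) ≠ 0 := by exact_mod_cast hN.ne'
  have hNt : (N : ENNReal) ≠ ⊤ := ENNReal.natCast_ne_top N
  have hNr : (0 : ℝ) < N := by exact_mod_cast hN
  have hPi : Integrable (branchAverage N f) unitLaw := by
    unfold branchAverage
    refine Integrable.const_mul (integrable_finsetSum _ fun j hj => ?_) _
    exact (integrable_map_measure hf.aestronglyMeasurable (by fun_prop)).1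
      (integrable_comp_branch hN hfi (Finset.mem_range.1 hj))
  have hmeas : Measurable fun x => ∫⁻ y, stripDiff f q N (x, y) ∂unitLaw :=
    (measurable_stripDiff hf q N).lintegral_prod_right'
  have hpt : ∀ x, ‖branchAverage N f x‖ₑ ^ q ≤
      ∫⁻ y, (N : ENNReal)⁻¹ * ∑ j ∈ Finset.range N,
        ‖f ((x + j) / N) - f ((y + j) / N)‖ₑ ^ q ∂unitLaw := by
    intro x
    have h1 : branchAverage N f x =
        ∫ y, (branchAverage N f x - branchAverage N f y) ∂unitLaw := by
      rw [integral_sub (integrable_const _) hPi, integral_branchAverage hN hf hfi, hf0]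
      simp
    rw [h1]
    refine (enorm_integral_rpow_le (by fun_prop) hq).trans (lintegral_mono fun y => ?_)
    have h2 : branchAverage N f x - branchAverage N f y = (N : ℝ)⁻¹ *
        ∑ j ∈ Finset.range N, (f ((x + j) / N) - f ((y + j) / N)) := by
      simp only [branchAverage, Finset.sum_sub_distrib, mul_sub]
    rw [h2]
    exact enorm_mean_rpow_le hN _ hq
  have hle : ∀ x ∈ Set.Ico (0 : ℝ) 1,
      ∫⁻ y, (N : ENNReal)⁻¹ * ∑ j ∈ Finset.range N,
        ‖f ((x + j) / N) - f ((y + j) / N)‖ₑ ^ q ∂unitLaw ≤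
      ∑ j ∈ Finset.range N, ∫⁻ y, stripDiff f q N ((x + j) / N, y) ∂unitLaw := by
    intro x hx
    rw [lintegral_const_mul _ (by fun_prop), lintegral_finsetSum _ (by fun_prop), Finset.mul_sum]
    refine Finset.sum_le_sum fun j hj => ?_
    rw [lintegral_unitLaw_eq_sum hN
      (g := fun y => stripDiff f q N ((x + j) / N, y)) (by fun_prop)]
    gcongr
    refine le_trans (lintegral_mono_ae ?_) (Finset.single_le_sum
      (f := fun i : ℕ => ∫⁻ y, stripDiff f q N ((x + j) / N, (y + i) / N) ∂unitLaw)
      (fun _ _ => zero_le) hj)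
    filter_upwards [ae_unitLaw_mem] with y hy
    rw [stripDiff, Set.indicator_of_mem]
    have h3 : (x + j) / N - (y + j) / N = (x - y) / N := by ring
    simp only [Set.mem_ofPred_eq, h3, abs_div, abs_of_pos hNr]
    gcongr
    rw [abs_le]
    constructor <;> linarith [hx.1, hx.2, hy.1, hy.2]
  calc ∫⁻ x, ‖branchAverage N f x‖ₑ ^ q ∂unitLaw
      ≤ ∫⁻ x, ∑ j ∈ Finset.range N,
          ∫⁻ y, stripDiff f q N ((x + j) / N, y) ∂unitLaw ∂unitLaw := by
        refine lintegral_mono_ae ?_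
        filter_upwards [ae_unitLaw_mem] with x hx using (hpt x).trans (hle x hx)
    _ = N * ∫⁻ x, ∫⁻ y, stripDiff f q N (x, y) ∂unitLaw ∂unitLaw := by
        rw [lintegral_unitLaw_eq_sum hN hmeas, ← mul_assoc, ENNReal.mul_inv_cancel hN0 hNt,
          one_mul, lintegral_finsetSum]
        intro j _
        exact hmeas.comp (by fun_prop)

lemma sum_two_pow_ite_le (c : ℝ) (hc : 0 ≤ c) (K : ℕ) :
    ∑ m ∈ Finset.range K, (if (2 : ℝ) ^ m ≤ c then (2 : ℝ) ^ m else 0) ≤ 2 * c := by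
  induction K with
  | zero => simpa using hc
  | succ K ih =>
    by_cases h : (2 : ℝ) ^ K ≤ c
    · calc ∑ m ∈ Finset.range (K + 1), (if (2 : ℝ) ^ m ≤ c then (2 : ℝ) ^ m else 0)
          ≤ ∑ m ∈ Finset.range (K + 1), (2 : ℝ) ^ m := by
            refine Finset.sum_le_sum fun m _ => ?_
            split_ifs
            · exact le_rfl
            · positivity
        _ ≤ (2 : ℝ) ^ (K + 1) := by
            rw [geom_sum_eq (by norm_num)]; norm_num
        _ ≤ 2 * c := by rw [pow_succ]; linarith
    · rw [Finset.sum_range_succ, if_neg h, add_zero]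
      exact ih

/-- The strips of width `2 ^ (-m)`, `n < m ≤ 2 n`, weighted by `2 ^ m`, add up to at most
`2 / |x - y|`, and on each of them `log (1 / |x - y|)` is at least `n log 2`. -/
lemma sum_stripDiff_le (f : ℝ → ℝ) {q β : ℝ} (hq : 0 < q) (hβ : 0 ≤ β) (n : ℕ) (x y : ℝ) :
    ENNReal.ofReal ((n * Real.log 2) ^ β) *
      ∑ m ∈ Finset.Ioc n (2 * n), (2 ^ m : ℕ) * stripDiff f q (2 ^ m) (x, y) ≤
    2 * ENNReal.ofReal (|f x - f y| ^ q / |x - y| * Real.log (1 / |x - y|) ^ β) := by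
  by_cases hxy : x = y
  · subst hxy
    have : ∀ N, stripDiff f q N (x, x) = 0 := by
      intro N; simp [stripDiff, Set.indicator, ENNReal.zero_rpow_of_pos hq]
    simp [this]
  have hd : 0 < |x - y| := abs_pos.2 (sub_ne_zero.2 hxy)
  set d := |x - y| with hd_def
  set a := |f x - f y| ^ q with ha
  have ha0 : 0 ≤ a := by positivity
  have hterm : ∀ m : ℕ, ((2 ^ m : ℕ) : ENNReal) * stripDiff f q (2 ^ m) (x, y) =
      ENNReal.ofReal ((if (2 : ℝ) ^ m ≤ 1 / d then (2 : ℝ) ^ m else 0) * a) := by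
    intro m
    have hiff : d ≤ 1 / ((2 ^ m : ℕ) : ℝ) ↔ (2 : ℝ) ^ m ≤ 1 / d := by
      push_cast
      rw [le_div_iff₀ (by positivity), le_div_iff₀ hd, mul_comm]
    by_cases h : (2 : ℝ) ^ m ≤ 1 / d
    · rw [if_pos h, stripDiff, Set.indicator_of_mem (by exact hiff.2 h),
        ENNReal.ofReal_mul (by positivity)]
      congr 1
      · rw [ENNReal.ofReal_pow (by norm_num)]; simp
      · rw [ha, ← ENNReal.ofReal_rpow_of_nonneg (abs_nonneg _) hq.le, ← Real.norm_eq_abs,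
          ofReal_norm]
    · rw [if_neg h, stripDiff, Set.indicator_of_notMem (by exact fun h' => h (hiff.1 h'))]
      simp
  have h2 : (2 : ENNReal) = ENNReal.ofReal 2 := by simp
  simp_rw [hterm]
  rw [← ENNReal.ofReal_sum_of_nonneg (fun m _ => by split_ifs <;> positivity),
    ← ENNReal.ofReal_mul (by positivity), h2, ← ENNReal.ofReal_mul (by norm_num), ← Finset.sum_mul]
  by_cases hn : (2 : ℝ) ^ n ≤ 1 / d
  · refine ENNReal.ofReal_le_ofReal ?_
    have hlog : n * Real.log 2 ≤ Real.log (1 / d) := by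
      rw [← Real.log_pow]; exact Real.log_le_log (by positivity) hn
    have hsum : ∑ m ∈ Finset.Ioc n (2 * n), (if (2 : ℝ) ^ m ≤ 1 / d then (2 : ℝ) ^ m else 0) ≤
        2 * (1 / d) := by
      refine le_trans (Finset.sum_le_sum_of_subset_of_nonneg ?_ ?_)
        (sum_two_pow_ite_le (1 / d) (by positivity) (2 * n + 1))
      · intro m hm; simp only [Finset.mem_Ioc, Finset.mem_range] at *; omega
      · intro m _ _; split_ifs <;> positivity
    calc (n * Real.log 2) ^ β *
          ((∑ m ∈ Finset.Ioc n (2 * n), (if (2 : ℝ) ^ m ≤ 1 / d then (2 : ℝ) ^ m else 0)) * a)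
        ≤ Real.log (1 / d) ^ β * (2 * (1 / d) * a) := by
          gcongr
          exact Real.rpow_nonneg ((by positivity : (0 : ℝ) ≤ n * Real.log 2).trans hlog) _
      _ = 2 * (a / d * Real.log (1 / d) ^ β) := by ring
  · have hz : ∑ m ∈ Finset.Ioc n (2 * n), (if (2 : ℝ) ^ m ≤ 1 / d then (2 : ℝ) ^ m else 0) = 0 := by
      refine Finset.sum_eq_zero fun m hm => if_neg fun h => hn (le_trans ?_ h)
      exact pow_le_pow_right₀ (by norm_num) (Finset.mem_Ioc.1 hm).1.le
    rw [hz, zero_mul, mul_zero, ENNReal.ofReal_zero]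
    exact zero_le

lemma LogWeightedIntegralFinite.congr_ae {f g : ℝ → ℝ} (hfg : f =ᵐ[unitLaw] g) {s δ : ℝ}
    (h : LogWeightedIntegralFinite f s δ) :
    ∫⁻ x, ∫⁻ y, ENNReal.ofReal
      (|g x - g y| ^ s / |x - y| * Real.log (1 / |x - y|) ^ (s - 1 + δ)) ∂unitLaw ∂unitLaw < ⊤ := by
  rw [LogWeightedIntegralFinite, ← unitLaw_eq_restrict_Icc] at h
  refine lt_of_eq_of_lt (lintegral_congr_ae ?_) h
  filter_upwards [hfg] with x hx
  refine lintegral_congr_ae ?_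
  filter_upwards [hfg] with y hy
  rw [hx, hy]

lemma lintegral_branchAverage_two_pow_anti {f : ℝ → ℝ} (hf : Measurable f) {s : ℝ} (hs : 1 ≤ s)
    {m n : ℕ} (hmn : m ≤ n) :
    ∫⁻ x, ‖branchAverage (2 ^ n) f x‖ₑ ^ s ∂unitLaw ≤
      ∫⁻ x, ‖branchAverage (2 ^ m) f x‖ₑ ^ s ∂unitLaw := by
  obtain ⟨k, rfl⟩ := Nat.exists_eq_add_of_le' hmn
  rw [pow_add, ← branchAverage_branchAverage (by positivity) (by positivity)]
  exact lintegral_branchAverage_rpow_le (by positivity) (by fun_prop) hs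

/-- Under the logarithmic integral condition the averages over the `4 ^ n` branches decay in `L^q`
like `n ^ (-1 - δ / q)`. Bounding a single one by its strip would lose a factor `n` in
the `q`-th power, which is regained by summing over `n < m ≤ 2 n` and using monotonicity. -/
lemma exists_lintegral_branchAverage_le {f : ℝ → ℝ} (hf : Measurable f)
    (hfi : Integrable f unitLaw) (hf0 : ∫ x, f x ∂unitLaw = 0) {q δ : ℝ} (hq : 1 ≤ q) (hδ : 0 < δ)
    (h : ∫⁻ x, ∫⁻ y, ENNReal.ofReal
      (|f x - f y| ^ q / |x - y| * Real.log (1 / |x - y|) ^ (q - 1 + δ)) ∂unitLaw ∂unitLaw < ⊤) :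
    ∃ C : ENNReal, C ≠ ⊤ ∧ ∀ n : ℕ, 1 ≤ n →
      ∫⁻ x, ‖branchAverage (2 ^ (2 * n)) f x‖ₑ ^ q ∂unitLaw ≤ C * (n : ENNReal) ^ (-(q + δ)) := by
  set I := ∫⁻ x, ∫⁻ y, ENNReal.ofReal
      (|f x - f y| ^ q / |x - y| * Real.log (1 / |x - y|) ^ (q - 1 + δ)) ∂unitLaw ∂unitLaw with hI
  set β := q - 1 + δ with hβ
  have hβ0 : 0 < β := by linarith
  set Λ := ENNReal.ofReal (Real.log 2 ^ β) with hΛ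
  have hΛ0 : Λ ≠ 0 := by
    have := Real.log_pos (by norm_num : (1 : ℝ) < 2)
    simp only [hΛ, ne_eq, ENNReal.ofReal_eq_zero, not_le]
    positivity
  refine ⟨Λ⁻¹ * (2 * I), ENNReal.mul_ne_top (ENNReal.inv_ne_top.2 hΛ0)
    (ENNReal.mul_ne_top (by simp) h.ne), fun n hn => ?_⟩
  have hn0 : (n : ENNReal) ≠ 0 := by exact_mod_cast (by omega : n ≠ 0)
  have hnt : (n : ENNReal) ≠ ⊤ := ENNReal.natCast_ne_top n
  set φ := ∫⁻ x, ‖branchAverage (2 ^ (2 * n)) f x‖ₑ ^ q ∂unitLaw with hφ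
  have hw : ENNReal.ofReal ((n * Real.log 2) ^ β) = (n : ENNReal) ^ β * Λ := by
    rw [Real.mul_rpow (by positivity) (by positivity), ENNReal.ofReal_mul (by positivity),
      ← ENNReal.ofReal_rpow_of_nonneg (by positivity) hβ0.le, ENNReal.ofReal_natCast]
  have hmain : (n : ENNReal) ^ β * Λ * (n * φ) ≤ 2 * I := by
    calc (n : ENNReal) ^ β * Λ * (n * φ)
        = ENNReal.ofReal ((n * Real.log 2) ^ β) * ∑ m ∈ Finset.Ioc n (2 * n), φ := by
          rw [hw, Finset.sum_const, Nat.card_Ioc, nsmul_eq_mul]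
          congr 3; omega
      _ ≤ ENNReal.ofReal ((n * Real.log 2) ^ β) * ∑ m ∈ Finset.Ioc n (2 * n),
          ((2 ^ m : ℕ) * ∫⁻ x, ∫⁻ y, stripDiff f q (2 ^ m) (x, y) ∂unitLaw ∂unitLaw) := by
          gcongr with m hm
          exact (lintegral_branchAverage_two_pow_anti hf hq (Finset.mem_Ioc.1 hm).2).trans
            (lintegral_branchAverage_rpow_le_stripDiff (by positivity) hf hfi hf0 hq)
      _ = ∫⁻ x, ∫⁻ y, ENNReal.ofReal ((n * Real.log 2) ^ β) *
            ∑ m ∈ Finset.Ioc n (2 * n), (2 ^ m : ℕ) * stripDiff f q (2 ^ m) (x, y)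
            ∂unitLaw ∂unitLaw := by
          have e1 : ∀ x m, Measurable fun y => ((2 ^ m : ℕ) : ENNReal) *
              stripDiff f q (2 ^ m) (x, y) := fun x m => by fun_prop
          have e2 : ∀ m, Measurable fun x => ∫⁻ y, stripDiff f q (2 ^ m) (x, y) ∂unitLaw :=
            fun m => (measurable_stripDiff hf q _).lintegral_prod_right'
          have e3 : ∀ m, Measurable fun x => ((2 ^ m : ℕ) : ENNReal) *
              ∫⁻ y, stripDiff f q (2 ^ m) (x, y) ∂unitLaw := fun m => (e2 m).const_mul _
          have e4 : ∀ x, ∫⁻ y, ENNReal.ofReal ((n * Real.log 2) ^ β) *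
              ∑ m ∈ Finset.Ioc n (2 * n), (2 ^ m : ℕ) * stripDiff f q (2 ^ m) (x, y) ∂unitLaw =
              ENNReal.ofReal ((n * Real.log 2) ^ β) * ∑ m ∈ Finset.Ioc n (2 * n),
                (2 ^ m : ℕ) * ∫⁻ y, stripDiff f q (2 ^ m) (x, y) ∂unitLaw := by
            intro x
            rw [lintegral_const_mul _ (Finset.measurable_fun_sum _ fun m _ => e1 x m),
              lintegral_finsetSum _ fun m _ => e1 x m]
            congr 1
            refine Finset.sum_congr rfl fun m _ => ?_
            rw [lintegral_const_mul _ (by fun_prop)]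
          simp_rw [e4]
          rw [lintegral_const_mul _ (Finset.measurable_fun_sum _ fun m _ => e3 m),
            lintegral_finsetSum _ fun m _ => e3 m]
          congr 1
          refine Finset.sum_congr rfl fun m _ => ?_
          rw [lintegral_const_mul _ (e2 m)]
      _ ≤ ∫⁻ x, ∫⁻ y, 2 * ENNReal.ofReal
            (|f x - f y| ^ q / |x - y| * Real.log (1 / |x - y|) ^ β) ∂unitLaw ∂unitLaw :=
          lintegral_mono fun x => lintegral_mono fun y =>
            sum_stripDiff_le f (by linarith) hβ0.le n x y
      _ = 2 * I := by
          simp_rw [lintegral_const_mul' (2 : ENNReal) _ (by simp)]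
          rw [hI]
  have hpow : (n : ENNReal) ^ (q + δ) = (n : ENNReal) ^ β * n := by
    nth_rewrite 3 [← ENNReal.rpow_one (n : ENNReal)]
    rw [← ENNReal.rpow_add _ _ hn0 hnt]
    congr 1; rw [hβ]; ring
  have hp0 : (n : ENNReal) ^ (q + δ) ≠ 0 := by
    simp [ENNReal.rpow_eq_zero_iff, hn0]
  have hpt : (n : ENNReal) ^ (q + δ) ≠ ⊤ := ENNReal.rpow_ne_top_of_nonneg (by linarith) hnt
  have h3 : φ * ((n : ENNReal) ^ (q + δ) * Λ) ≤ 2 * I := by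
    rw [hpow]
    calc φ * ((n : ENNReal) ^ β * n * Λ) = (n : ENNReal) ^ β * Λ * (n * φ) := by ring
      _ ≤ _ := hmain
  have h4 := (ENNReal.le_div_iff_mul_le (Or.inl (mul_ne_zero hp0 hΛ0))
    (Or.inl (ENNReal.mul_ne_top hpt ENNReal.ofReal_ne_top))).2 h3
  refine h4.trans (le_of_eq ?_)
  rw [div_eq_mul_inv, ENNReal.mul_inv (Or.inl hp0) (Or.inl hpt), ENNReal.rpow_neg]
  ring

/-- Hölder interpolation of the decay in `L^q` with the boundedness in `L^r`. -/
lemma exists_lintegral_branchAverage_interp_le {f : ℝ → ℝ} (hf : Measurable f) {q r s κ : ℝ}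
    (hq : 1 ≤ q) (hqs : q < s) (hsr : s < r) (hκ : (s - 1) * (r - q) ≤ κ * (r - s))
    (hfr : ∫⁻ x, ‖f x‖ₑ ^ r ∂unitLaw ≠ ⊤)
    (h : ∃ C : ENNReal, C ≠ ⊤ ∧ ∀ n : ℕ, 1 ≤ n →
      ∫⁻ x, ‖branchAverage (2 ^ (2 * n)) f x‖ₑ ^ q ∂unitLaw ≤ C * (n : ENNReal) ^ (-κ)) :
    ∃ C : ENNReal, C ≠ ⊤ ∧ ∀ n : ℕ, 1 ≤ n →
      ∫⁻ x, ‖branchAverage (2 ^ (2 * n)) f x‖ₑ ^ s ∂unitLaw ≤ C * (n : ENNReal) ^ (-(s - 1)) := by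
  obtain ⟨C, hC, h⟩ := h
  have hrq : 0 < r - q := by linarith
  set a := (r - s) / (r - q) with ha
  set b := (s - q) / (r - q) with hb
  have ha0 : 0 < a := div_pos (by linarith) hrq
  have hb0 : 0 < b := div_pos (by linarith) hrq
  have hab : a + b = 1 := by rw [ha, hb]; field_simp; ring
  have hs : q * a + r * b = s := by rw [ha, hb]; field_simp; ring
  refine ⟨C ^ a * (∫⁻ x, ‖f x‖ₑ ^ r ∂unitLaw) ^ b, ENNReal.mul_ne_top
    (ENNReal.rpow_ne_top_of_nonneg ha0.le hC) (ENNReal.rpow_ne_top_of_nonneg hb0.le hfr),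
    fun n hn => ?_⟩
  set g := branchAverage (2 ^ (2 * n)) f with hg
  have hgm : Measurable g := by fun_prop
  have hsplit : ∀ x, ‖g x‖ₑ ^ s = (‖g x‖ₑ ^ q) ^ a * (‖g x‖ₑ ^ r) ^ b := by
    intro x
    rw [← ENNReal.rpow_mul, ← ENNReal.rpow_mul, ← ENNReal.rpow_add_of_nonneg _ _ (by positivity)
      (mul_nonneg (by linarith) hb0.le), hs]
  calc ∫⁻ x, ‖g x‖ₑ ^ s ∂unitLaw = ∫⁻ x, (‖g x‖ₑ ^ q) ^ a * (‖g x‖ₑ ^ r) ^ b ∂unitLaw :=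
        lintegral_congr hsplit
    _ ≤ (∫⁻ x, ‖g x‖ₑ ^ q ∂unitLaw) ^ a * (∫⁻ x, ‖g x‖ₑ ^ r ∂unitLaw) ^ b :=
        ENNReal.lintegral_mul_norm_pow_le (by fun_prop) (by fun_prop) ha0.le hb0.le hab
    _ ≤ (C * (n : ENNReal) ^ (-κ)) ^ a * (∫⁻ x, ‖f x‖ₑ ^ r ∂unitLaw) ^ b := by
        refine mul_le_mul' (ENNReal.rpow_le_rpow (h n hn) ha0.le)
          (ENNReal.rpow_le_rpow ?_ hb0.le)
        exact lintegral_branchAverage_rpow_le (by positivity) hf (by linarith)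
    _ = C ^ a * (∫⁻ x, ‖f x‖ₑ ^ r ∂unitLaw) ^ b * (n : ENNReal) ^ (-κ * a) := by
        rw [ENNReal.mul_rpow_of_nonneg _ _ ha0.le, ← ENNReal.rpow_mul]; ring
    _ ≤ _ := by
        gcongr
        · exact_mod_cast hn
        · have : s - 1 ≤ κ * a := by
            rw [ha, ← mul_div_assoc, le_div_iff₀ hrq]; exact hκ
          linarith

/-! ### A moment inequality for sums of orthogonal terms -/

lemma abs_one_add_rpow_le {s : ℝ} (hs1 : 1 ≤ s) (hs2 : s ≤ 2) (t : ℝ) :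
    |1 + t| ^ s ≤ 1 + s * t + 4 * |t| ^ s := by
  have hs0 : 0 ≤ s := by linarith
  have hts : 0 ≤ |t| ^ s := by positivity
  rcases le_or_gt |t| 1 with ht | ht
  · obtain ⟨ht1, ht2⟩ := abs_le.1 ht
    have h1 : 0 ≤ 1 + t := by linarith
    have hb : (1 + t) ^ (s - 1) ≤ 1 + (s - 1) * t :=
      rpow_one_add_le_one_add_mul_self ht1 (by linarith) (by linarith)
    have hsq : t ^ 2 ≤ |t| ^ s := by
      rw [← sq_abs, ← Real.rpow_two]
      exact Real.rpow_le_rpow_of_exponent_ge' (abs_nonneg _) ht (by linarith) hs2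
    have hmul : |1 + t| ^ s = (1 + t) * (1 + t) ^ (s - 1) := by
      rw [abs_of_nonneg h1]
      rcases h1.eq_or_lt with h | h
      · rw [← h, Real.zero_rpow (by linarith), zero_mul]
      · rw [mul_comm, ← Real.rpow_add_one h.ne', sub_add_cancel]
    rw [hmul]
    nlinarith [mul_le_mul_of_nonneg_left hb h1, sq_nonneg t]
  · have hone : |t| ≤ |t| ^ s := Real.self_le_rpow_of_one_le ht.le hs1
    rcases le_or_gt 0 t with h | h
    · rw [abs_of_nonneg h] at ht hts hone ⊢
      have h4 : (2 : ℝ) ^ s ≤ 4 := by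
        calc (2 : ℝ) ^ s ≤ (2 : ℝ) ^ (2 : ℝ) :=
              Real.rpow_le_rpow_of_exponent_le (by norm_num) hs2
          _ = 4 := by norm_num
      have : |1 + t| ^ s ≤ 4 * t ^ s := by
        rw [abs_of_nonneg (by linarith)]
        calc (1 + t) ^ s ≤ (2 * t) ^ s := Real.rpow_le_rpow (by linarith) (by linarith) hs0
          _ = 2 ^ s * t ^ s := Real.mul_rpow (by norm_num) h
          _ ≤ 4 * t ^ s := by gcongr
      nlinarith
    · rw [abs_of_neg h] at ht hts hone ⊢
      have : |1 + t| ^ s ≤ (-t) ^ s :=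
        Real.rpow_le_rpow (abs_nonneg _) (abs_le.2 ⟨by linarith, by linarith⟩) hs0
      nlinarith

/-- A first-order expansion of `|a + b| ^ s` for `1 ≤ s ≤ 2`; the derivative `|a| ^ (s - 1) sgn a`
is written `|a| ^ s / a`, which is correctly `0` at `a = 0`. -/
lemma abs_add_rpow_le {s : ℝ} (hs1 : 1 ≤ s) (hs2 : s ≤ 2) (a b : ℝ) :
    |a + b| ^ s ≤ |a| ^ s + s * (|a| ^ s / a * b) + 4 * |b| ^ s := by
  rcases eq_or_ne a 0 with rfl | ha
  · have : 0 ≤ |b| ^ s := by positivity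
    simp only [zero_add, div_zero, zero_mul, mul_zero, add_zero]
    have : 0 ≤ |(0 : ℝ)| ^ s := by positivity
    linarith
  · have h := abs_one_add_rpow_le hs1 hs2 (b / a)
    have ha' : 0 < |a| ^ s := Real.rpow_pos_of_pos (abs_pos.2 ha) s
    have e : |a + b| ^ s = |a| ^ s * |1 + b / a| ^ s := by
      rw [← Real.mul_rpow (abs_nonneg _) (abs_nonneg _), ← abs_mul, mul_add, mul_one,
        mul_div_cancel₀ _ ha]
    have e2 : |a| ^ s * |b / a| ^ s = |b| ^ s := by
      rw [← Real.mul_rpow (abs_nonneg _) (abs_nonneg _), ← abs_mul, mul_div_cancel₀ _ ha]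
    rw [e]
    calc |a| ^ s * |1 + b / a| ^ s ≤ |a| ^ s * (1 + s * (b / a) + 4 * |b / a| ^ s) := by gcongr
      _ = |a| ^ s + s * (|a| ^ s / a * b) + 4 * (|a| ^ s * |b / a| ^ s) := by ring
      _ = _ := by rw [e2]

lemma abs_rpow_div_mul_le {s : ℝ} (hs1 : 1 ≤ s) (a b : ℝ) :
    |(|a| ^ s / a * b)| ≤ |a| ^ s + |b| ^ s := by
  have hs0 : 0 ≤ s := by linarith
  have hA : 0 ≤ |a| ^ s := by positivity
  have hB : 0 ≤ |b| ^ s := by positivity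
  rcases eq_or_ne a 0 with rfl | ha
  · simpa using by positivity
  have ha' := abs_pos.2 ha
  rw [abs_mul, abs_div, abs_of_nonneg hA]
  rcases le_total |b| |a| with h | h
  · calc |a| ^ s / |a| * |b| ≤ |a| ^ s / |a| * |a| := by gcongr
      _ = |a| ^ s := by field_simp
      _ ≤ _ := by linarith
  · have hb' : 0 < |b| := ha'.trans_le h
    calc |a| ^ s / |a| * |b| = |a| ^ (s - 1) * |b| := by rw [Real.rpow_sub_one ha'.ne']
      _ ≤ |b| ^ (s - 1) * |b| := by
          gcongr
      _ = |b| ^ s := by rw [← Real.rpow_add_one hb'.ne', sub_add_cancel]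
      _ ≤ _ := by linarith

lemma eLpNorm_ofReal_eq {s : ℝ} (hs : 0 < s) (g : ℝ → ℝ) :
    eLpNorm g (ENNReal.ofReal s) unitLaw = (∫⁻ x, ‖g x‖ₑ ^ s ∂unitLaw) ^ (1 / s) := by
  rw [eLpNorm_eq_lintegral_rpow_enorm_toReal (by simpa using hs) (by simp),
    ENNReal.toReal_ofReal hs.le]

lemma MeasureTheory.MemLp.integrable_abs_rpow {s : ℝ} (hs : 0 < s) {g : ℝ → ℝ}
    (hg : MemLp g (ENNReal.ofReal s) unitLaw) : Integrable (fun x => |g x| ^ s) unitLaw := by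
  have := hg.integrable_norm_rpow (by simpa using hs) (by simp)
  simpa [ENNReal.toReal_ofReal hs.le] using this

lemma ofReal_integral_abs_rpow {s : ℝ} (hs : 0 < s) {g : ℝ → ℝ}
    (hg : MemLp g (ENNReal.ofReal s) unitLaw) :
    ENNReal.ofReal (∫ x, |g x| ^ s ∂unitLaw) = ∫⁻ x, ‖g x‖ₑ ^ s ∂unitLaw := by
  rw [ofReal_integral_eq_lintegral_ofReal (hg.integrable_abs_rpow hs)
    (Filter.Eventually.of_forall fun x => by positivity)]
  refine lintegral_congr fun x => ?_
  rw [← ENNReal.ofReal_rpow_of_nonneg (abs_nonneg _) hs.le, ← Real.norm_eq_abs, ofReal_norm]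

/-- One step of the von Bahr–Esseen inequality. -/
lemma integral_abs_comp_add_rpow_le {s : ℝ} (hs1 : 1 ≤ s) (hs2 : s ≤ 2) {N : ℕ} (hN : 0 < N)
    {a b : ℝ → ℝ} (ham : Measurable a) (hbm : Measurable b)
    (ha : MemLp a (ENNReal.ofReal s) unitLaw) (hb : MemLp b (ENNReal.ofReal s) unitLaw)
    (hb0 : ∀ x ∈ Set.Ico (0 : ℝ) 1, branchAverage N b x = 0) :
    ∫ x, |a (mulMod N x) + b x| ^ s ∂unitLaw ≤
      ∫ x, |a x| ^ s ∂unitLaw + 4 * ∫ x, |b x| ^ s ∂unitLaw := by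
  have hs0 : 0 < s := by linarith
  have hD := measurePreserving_mulMod hN
  have haD : MemLp (fun x => a (mulMod N x)) (ENNReal.ofReal s) unitLaw :=
    ha.comp_measurePreserving hD
  have i1 := haD.integrable_abs_rpow hs0
  have i2 := hb.integrable_abs_rpow hs0
  have i3 : Integrable (fun x => |a (mulMod N x)| ^ s / a (mulMod N x) * b x) unitLaw := by
    refine (i1.add i2).mono' (by fun_prop) (Filter.Eventually.of_forall fun x => ?_)
    exact abs_rpow_div_mul_le hs1 _ _
  have i4 := (haD.add hb).integrable_abs_rpow hs0
  have hz : ∫ x, |a (mulMod N x)| ^ s / a (mulMod N x) * b x ∂unitLaw = 0 :=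
    integral_comp_mulMod_mul_eq_zero (ψ := fun y => |a y| ^ s / a y) hN hbm (by fun_prop) i3 hb0
  have hinv : ∫ x, |a (mulMod N x)| ^ s ∂unitLaw = ∫ x, |a x| ^ s ∂unitLaw := by
    have hm : Measurable fun y => |a y| ^ s := by fun_prop
    have := integral_map (μ := unitLaw) hD.measurable.aemeasurable hm.aestronglyMeasurable
    rw [hD.map_eq] at this
    exact this.symm
  calc ∫ x, |a (mulMod N x) + b x| ^ s ∂unitLaw
      ≤ ∫ x, (|a (mulMod N x)| ^ s + s * (|a (mulMod N x)| ^ s / a (mulMod N x) * b x)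
          + 4 * |b x| ^ s) ∂unitLaw :=
        integral_mono i4 ((i1.add (i3.const_mul s)).add (i2.const_mul 4))
          fun x => abs_add_rpow_le hs1 hs2 _ _
    _ = _ := by
        have e1 := integral_add (i1.add (i3.const_mul s)) (i2.const_mul 4)
        have e2 := integral_add i1 (i3.const_mul s)
        simp only [Pi.add_apply] at e1
        rw [e1, e2, integral_const_mul, integral_const_mul, hz, hinv]
        ring

/-- The sum of `h` along the first `n` points of the orbit of `x` under `x ↦ N x mod 1`. -/
noncomputable def orbitSum (h : ℝ → ℝ) (N n : ℕ) (x : ℝ) : ℝ :=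
  ∑ j ∈ Finset.range n, h (mulMod (N ^ j) x)

@[fun_prop]
lemma measurable_orbitSum {h : ℝ → ℝ} (hh : Measurable h) (N n : ℕ) :
    Measurable (orbitSum h N n) := by
  unfold orbitSum; fun_prop

lemma mulMod_one {x : ℝ} (hx : x ∈ Set.Ico (0 : ℝ) 1) : mulMod 1 x = x := by
  simpa [mulMod] using Int.fract_eq_self.2 hx

lemma orbitSum_succ (h : ℝ → ℝ) (N n : ℕ) {x : ℝ} (hx : x ∈ Set.Ico (0 : ℝ) 1) :
    orbitSum h N (n + 1) x = orbitSum h N n (mulMod N x) + h x := by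
  simp only [orbitSum, Finset.sum_range_succ', pow_zero, mulMod_one hx, mulMod_mulMod, pow_succ]

lemma memLp_orbitSum {p : ENNReal} {h : ℝ → ℝ} (hh : MemLp h p unitLaw) {N : ℕ} (hN : 0 < N)
    (n : ℕ) : MemLp (orbitSum h N n) p unitLaw :=
  memLp_finsetSum _ fun j _ =>
    hh.comp_measurePreserving (measurePreserving_mulMod (pow_pos hN j))

/-- A von Bahr–Esseen inequality: the sum of `n` reversed martingale differences along an orbit has
`s`-th moment of order `n`. -/
lemma integral_abs_orbitSum_rpow_le {s : ℝ} (hs1 : 1 ≤ s) (hs2 : s ≤ 2) {N : ℕ} (hN : 0 < N)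
    {d : ℝ → ℝ} (hdm : Measurable d) (hd : MemLp d (ENNReal.ofReal s) unitLaw)
    (hd0 : ∀ x ∈ Set.Ico (0 : ℝ) 1, branchAverage N d x = 0) (n : ℕ) :
    ∫ x, |orbitSum d N n x| ^ s ∂unitLaw ≤ n * (4 * ∫ x, |d x| ^ s ∂unitLaw) := by
  induction n with
  | zero => simp [orbitSum, Real.zero_rpow (by linarith : s ≠ 0)]
  | succ n ih =>
    have e : ∫ x, |orbitSum d N (n + 1) x| ^ s ∂unitLaw =
        ∫ x, |orbitSum d N n (mulMod N x) + d x| ^ s ∂unitLaw := by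
      refine integral_congr_ae ?_
      filter_upwards [ae_unitLaw_mem] with x hx
      rw [orbitSum_succ d N n hx]
    have := integral_abs_comp_add_rpow_le hs1 hs2 hN (measurable_orbitSum hdm N n) hdm
      (memLp_orbitSum hd hN n) hd hd0
    rw [e]
    push_cast
    linarith

lemma eLpNorm_orbitSum_le {s : ℝ} (hs1 : 1 ≤ s) (hs2 : s ≤ 2) {N : ℕ} (hN : 0 < N)
    {d : ℝ → ℝ} (hdm : Measurable d) (hd : MemLp d (ENNReal.ofReal s) unitLaw)
    (hd0 : ∀ x ∈ Set.Ico (0 : ℝ) 1, branchAverage N d x = 0) (n : ℕ) :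
    eLpNorm (orbitSum d N n) (ENNReal.ofReal s) unitLaw ≤
      4 * (n : ENNReal) ^ (1 / s) * eLpNorm d (ENNReal.ofReal s) unitLaw := by
  have hs0 : 0 < s := by linarith
  have h := ENNReal.ofReal_le_ofReal (integral_abs_orbitSum_rpow_le hs1 hs2 hN hdm hd hd0 n)
  rw [ENNReal.ofReal_mul (by positivity), ENNReal.ofReal_mul (by norm_num),
    ofReal_integral_abs_rpow hs0 hd, ofReal_integral_abs_rpow hs0 (memLp_orbitSum hd hN n),
    ENNReal.ofReal_natCast, ENNReal.ofReal_ofNat] at h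
  rw [eLpNorm_ofReal_eq hs0, eLpNorm_ofReal_eq hs0]
  calc _ ≤ ((n : ENNReal) * (4 * ∫⁻ x, ‖d x‖ₑ ^ s ∂unitLaw)) ^ (1 / s) := by gcongr
    _ = 4 ^ (1 / s) * (n : ENNReal) ^ (1 / s) * (∫⁻ x, ‖d x‖ₑ ^ s ∂unitLaw) ^ (1 / s) := by
        rw [ENNReal.mul_rpow_of_nonneg _ _ (by positivity),
          ENNReal.mul_rpow_of_nonneg _ _ (by positivity)]
        ring
    _ ≤ _ := by
        gcongr
        calc (4 : ENNReal) ^ (1 / s) ≤ 4 ^ (1 : ℝ) := by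
              refine ENNReal.rpow_le_rpow_of_exponent_le (by norm_num) ?_
              rw [div_le_one hs0]; exact hs1
          _ = 4 := by simp

/-! ### Moments of dyadic blocks -/

lemma eLpNorm_branchAverage_le {s : ℝ} (hs1 : 1 ≤ s) {N : ℕ} (hN : 0 < N) {f : ℝ → ℝ}
    (hf : Measurable f) :
    eLpNorm (branchAverage N f) (ENNReal.ofReal s) unitLaw ≤
      eLpNorm f (ENNReal.ofReal s) unitLaw := by
  rw [eLpNorm_ofReal_eq (by linarith), eLpNorm_ofReal_eq (by linarith)]
  exact ENNReal.rpow_le_rpow (lintegral_branchAverage_rpow_le hN hf hs1) (by positivity)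

lemma branch_mem {N j : ℕ} (hj : j < N) {x : ℝ} (hx : x ∈ Set.Ico (0 : ℝ) 1) :
    (x + j) / N ∈ Set.Ico (0 : ℝ) 1 := by
  have hN : (0 : ℝ) < N := by exact_mod_cast (by omega : 0 < N)
  have hj' : (j : ℝ) + 1 ≤ N := by exact_mod_cast hj
  have h0 : (0 : ℝ) ≤ j := j.cast_nonneg
  constructor
  · exact div_nonneg (by linarith [hx.1]) hN.le
  · rw [div_lt_one hN]; linarith [hx.2]

lemma branchAverage_congr {N : ℕ} {f g : ℝ → ℝ} (h : ∀ x ∈ Set.Ico (0 : ℝ) 1, f x = g x) {x : ℝ}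
    (hx : x ∈ Set.Ico (0 : ℝ) 1) : branchAverage N f x = branchAverage N g x := by
  unfold branchAverage
  congr 1
  exact Finset.sum_congr rfl fun j hj => h _ (branch_mem (Finset.mem_range.1 hj) hx)

/-- The part of `h` that is orthogonal to the functions of `N x mod 1`. -/
noncomputable def branchFluctuation (N : ℕ) (h : ℝ → ℝ) (x : ℝ) : ℝ :=
  h x - branchAverage N h (mulMod N x)

@[fun_prop]
lemma measurable_branchFluctuation (N : ℕ) {h : ℝ → ℝ} (hh : Measurable h) :
    Measurable (branchFluctuation N h) := by
  unfold branchFluctuation; fun_prop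

lemma branchAverage_branchFluctuation {N : ℕ} (hN : 0 < N) (h : ℝ → ℝ) {x : ℝ}
    (hx : x ∈ Set.Ico (0 : ℝ) 1) : branchAverage N (branchFluctuation N h) x = 0 := by
  have hN' : (N : ℝ) ≠ 0 := by exact_mod_cast hN.ne'
  simp only [branchFluctuation, branchAverage, mulMod_branch hN _ hx, Finset.sum_sub_distrib,
    Finset.sum_const, Finset.card_range, nsmul_eq_mul, mul_sub]
  field_simp
  ring

/-- Pairing the terms of an orbit sum: `h + h ∘ D = (h - P h ∘ D) + (h + P h) ∘ D`, where
`D x = N x mod 1` and `P` is its transfer operator. -/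
lemma orbitSum_two_mul (h : ℝ → ℝ) (N n : ℕ) (x : ℝ) :
    orbitSum h N (n * 2) x = orbitSum (branchFluctuation N h) (N ^ 2) n x +
      orbitSum (h + branchAverage N h) (N ^ 2) n (mulMod N x) := by
  induction n with
  | zero => simp [orbitSum]
  | succ n ih =>
    have e : (n + 1) * 2 = n * 2 + 1 + 1 := by ring
    have e2 : N * (N ^ 2) ^ n = N ^ (n * 2 + 1) := by ring
    have e3 : (N ^ 2) ^ n * N = N ^ (n * 2 + 1) := by ring
    have e4 : (N ^ 2) ^ n = N ^ (n * 2) := by ring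
    rw [e]
    simp only [orbitSum, Finset.sum_range_succ, branchFluctuation, Pi.add_apply, mulMod_mulMod] at ih ⊢
    rw [ih, e2, e3, e4]
    ring

/-- The norm of an orbit sum of length `2 n` is bounded by a reversed martingale part and an orbit
sum of length `n` at twice the time scale. -/
lemma eLpNorm_orbitSum_two_mul_le {s : ℝ} (hs1 : 1 ≤ s) (hs2 : s ≤ 2) {N : ℕ} (hN : 0 < N)
    {h : ℝ → ℝ} (hhm : Measurable h) (hh : MemLp h (ENNReal.ofReal s) unitLaw) (n : ℕ) :
    eLpNorm (orbitSum h N (n * 2)) (ENNReal.ofReal s) unitLaw ≤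
      8 * (n : ENNReal) ^ (1 / s) * eLpNorm h (ENNReal.ofReal s) unitLaw +
      eLpNorm (orbitSum (h + branchAverage N h) (N ^ 2) n) (ENNReal.ofReal s) unitLaw := by
  have hs : (1 : ENNReal) ≤ ENNReal.ofReal s := by simpa using ENNReal.ofReal_le_ofReal hs1
  have hD := measurePreserving_mulMod hN
  have hP : MemLp (branchAverage N h) (ENNReal.ofReal s) unitLaw :=
    ⟨by fun_prop, (eLpNorm_branchAverage_le hs1 hN hhm).trans_lt hh.2⟩
  have hdL : MemLp (branchFluctuation N h) (ENNReal.ofReal s) unitLaw :=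
    hh.sub (hP.comp_measurePreserving hD)
  have hd : eLpNorm (branchFluctuation N h) (ENNReal.ofReal s) unitLaw ≤
      2 * eLpNorm h (ENNReal.ofReal s) unitLaw := by
    calc _ ≤ eLpNorm h (ENNReal.ofReal s) unitLaw +
          eLpNorm (branchAverage N h ∘ mulMod N) (ENNReal.ofReal s) unitLaw :=
        eLpNorm_sub_le hhm.aestronglyMeasurable
          ((measurable_branchAverage N hhm).comp (measurable_mulMod N)).aestronglyMeasurable hs
      _ ≤ eLpNorm h (ENNReal.ofReal s) unitLaw + eLpNorm h (ENNReal.ofReal s) unitLaw := by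
        rw [eLpNorm_comp_measurePreserving (by fun_prop) hD]
        gcongr
        exact eLpNorm_branchAverage_le hs1 hN hhm
      _ = _ := by ring
  have h0 : ∀ x ∈ Set.Ico (0 : ℝ) 1, branchAverage (N ^ 2) (branchFluctuation N h) x = 0 := by
    intro x hx
    rw [sq, ← branchAverage_branchAverage hN hN,
      branchAverage_congr (g := 0) (fun y hy => branchAverage_branchFluctuation hN h hy) hx]
    simp [branchAverage]
  have e : orbitSum h N (n * 2) = orbitSum (branchFluctuation N h) (N ^ 2) n +
      orbitSum (h + branchAverage N h) (N ^ 2) n ∘ mulMod N := by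
    ext x; exact orbitSum_two_mul h N n x
  have hm : Measurable (h + branchAverage N h) := hhm.add (by fun_prop)
  have hm' := measurable_orbitSum hm (N ^ 2) n
  rw [e]
  refine (eLpNorm_add_le (by fun_prop)
    (hm'.comp (measurable_mulMod N)).aestronglyMeasurable hs).trans ?_
  rw [eLpNorm_comp_measurePreserving hm'.aestronglyMeasurable hD]
  gcongr
  calc _ ≤ 4 * (n : ENNReal) ^ (1 / s) *
        eLpNorm (branchFluctuation N h) (ENNReal.ofReal s) unitLaw :=
      eLpNorm_orbitSum_le hs1 hs2 (by positivity) (by fun_prop) hdL h0 n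
    _ ≤ 4 * (n : ENNReal) ^ (1 / s) * (2 * eLpNorm h (ENNReal.ofReal s) unitLaw) := by gcongr
    _ = _ := by ring

/-- `∑_{t < 2 ^ k} P ^ t f`, where `P` is the transfer operator of `x ↦ 2 x mod 1`: the conditional
expectation of a block of `2 ^ k` terms `f (X_t)` given the first point `X_0` of the block. -/
noncomputable def averageSum (f : ℝ → ℝ) (k : ℕ) : ℝ → ℝ :=
  ∑ t ∈ Finset.range (2 ^ k), branchAverage (2 ^ t) f

@[fun_prop]
lemma measurable_averageSum {f : ℝ → ℝ} (hf : Measurable f) (k : ℕ) :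
    Measurable (averageSum f k) := by
  unfold averageSum
  exact Finset.sum_induction _ Measurable (fun _ _ => Measurable.add) measurable_const
    fun t _ => measurable_branchAverage _ hf

lemma branchAverage_sum {ι : Type*} (S : Finset ι) (g : ι → ℝ → ℝ) (N : ℕ) :
    branchAverage N (∑ t ∈ S, g t) = ∑ t ∈ S, branchAverage N (g t) := by
  ext x
  simp only [branchAverage, Finset.sum_apply]
  rw [Finset.sum_comm, Finset.mul_sum]

lemma averageSum_succ (f : ℝ → ℝ) (k : ℕ) :
    averageSum f (k + 1) = averageSum f k + branchAverage (2 ^ 2 ^ k) (averageSum f k) := by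
  rw [averageSum, averageSum, pow_succ, mul_two, Finset.sum_range_add, branchAverage_sum]
  congr 1
  refine Finset.sum_congr rfl fun t _ => ?_
  rw [branchAverage_branchAverage (by positivity) (by positivity), pow_add]

lemma eLpNorm_averageSum_le {s : ℝ} (hs1 : 1 ≤ s) {f : ℝ → ℝ} (hf : Measurable f) {B θ : ENNReal}
    (hθ : 1 ≤ θ) (hB : eLpNorm f (ENNReal.ofReal s) unitLaw ≤ B)
    (hdec : ∀ k : ℕ, 2 ^ k * eLpNorm (branchAverage (2 ^ 2 ^ k) f) (ENNReal.ofReal s) unitLaw ≤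
      B * θ ^ k) (k : ℕ) :
    eLpNorm (averageSum f k) (ENNReal.ofReal s) unitLaw ≤ B * (k + 1) * θ ^ k := by
  have hs : (1 : ENNReal) ≤ ENNReal.ofReal s := by simpa using ENNReal.ofReal_le_ofReal hs1
  induction k with
  | zero => simpa [averageSum, branchAverage_one] using hB
  | succ k ih =>
    have h2 : eLpNorm (branchAverage (2 ^ 2 ^ k) (averageSum f k)) (ENNReal.ofReal s) unitLaw ≤
        B * θ ^ k := by
      rw [averageSum, branchAverage_sum]
      refine (eLpNorm_sum_le (fun t _ => by fun_prop) hs).trans (le_trans ?_ (hdec k))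
      calc _ ≤ ∑ t ∈ Finset.range (2 ^ k),
            eLpNorm (branchAverage (2 ^ 2 ^ k) f) (ENNReal.ofReal s) unitLaw := by
            refine Finset.sum_le_sum fun t _ => ?_
            rw [branchAverage_branchAverage (by positivity) (by positivity), mul_comm,
              ← branchAverage_branchAverage (by positivity) (by positivity)]
            exact eLpNorm_branchAverage_le hs1 (by positivity) (by fun_prop)
        _ = _ := by simp
    rw [averageSum_succ]
    calc _ ≤ B * (k + 1) * θ ^ k + B * θ ^ k :=
          (eLpNorm_add_le (by fun_prop) (by fun_prop) hs).trans (add_le_add ih h2)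
      _ = B * ((k + 1 : ℕ) + 1) * θ ^ k := by push_cast; ring
      _ ≤ _ := by
          gcongr
          · exact k.le_succ

/-- If `2 ^ k ‖P ^ (2 ^ k) f‖_s` is at most of order `2 ^ (k / s)`, then blocks of `2 ^ l` terms have
`L^s` norm of order `2 ^ (l / s)`, up to a power of `l`. -/
lemma eLpNorm_orbitSum_averageSum_le {s : ℝ} (hs1 : 1 ≤ s) (hs2 : s ≤ 2) {f : ℝ → ℝ}
    (hf : Measurable f) {B : ENNReal} (hBt : B ≠ ⊤)
    (hB : eLpNorm f (ENNReal.ofReal s) unitLaw ≤ B)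
    (hdec : ∀ k : ℕ, 2 ^ k * eLpNorm (branchAverage (2 ^ 2 ^ k) f) (ENNReal.ofReal s) unitLaw ≤
      B * ((2 : ENNReal) ^ (1 / s)) ^ k) (l k : ℕ) :
    eLpNorm (orbitSum (averageSum f k) (2 ^ 2 ^ k) (2 ^ l)) (ENNReal.ofReal s) unitLaw ≤
      8 * B * (l + 1) * (k + l + 1) * ((2 : ENNReal) ^ (1 / s)) ^ (k + l) := by
  set θ := (2 : ENNReal) ^ (1 / s) with hθdef
  have hθ : 1 ≤ θ := ENNReal.one_le_rpow (by norm_num) (by positivity)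
  have hθt : θ ≠ ⊤ := ENNReal.rpow_ne_top_of_nonneg (by positivity) (by simp)
  have havg := eLpNorm_averageSum_le hs1 hf hθ hB hdec
  have hmem : ∀ k, MemLp (averageSum f k) (ENNReal.ofReal s) unitLaw := fun k =>
    ⟨by fun_prop, (havg k).trans_lt (by
      refine lt_top_iff_ne_top.2 (ENNReal.mul_ne_top (ENNReal.mul_ne_top hBt ?_)
        (ENNReal.pow_ne_top hθt))
      exact_mod_cast ENNReal.natCast_ne_top (k + 1))⟩
  induction l generalizing k with
  | zero =>
    have e : orbitSum (averageSum f k) (2 ^ 2 ^ k) (2 ^ 0) = averageSum f k ∘ mulMod 1 := by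
      ext x; simp [orbitSum]
    rw [e, eLpNorm_comp_measurePreserving (by fun_prop) (measurePreserving_mulMod one_pos)]
    refine (havg k).trans ?_
    simp only [CharP.cast_eq_zero, zero_add, add_zero, mul_one]
    gcongr
    exact le_mul_of_one_le_left' (by norm_num)
  | succ l ih =>
    have hpow : ((2 ^ l : ℕ) : ENNReal) ^ (1 / s) = θ ^ l := by
      rw [hθdef, ← ENNReal.rpow_natCast, ← ENNReal.rpow_mul, mul_comm, ENNReal.rpow_mul,
        ENNReal.rpow_natCast]
      norm_num
    have h := eLpNorm_orbitSum_two_mul_le hs1 hs2 (N := 2 ^ 2 ^ k) (by positivity)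
      (by fun_prop) (hmem k) (2 ^ l)
    rw [← averageSum_succ, ← pow_mul, ← pow_succ, ← pow_succ, hpow] at h
    refine h.trans ?_
    calc 8 * θ ^ l * eLpNorm (averageSum f k) (ENNReal.ofReal s) unitLaw +
          eLpNorm (orbitSum (averageSum f (k + 1)) (2 ^ 2 ^ (k + 1)) (2 ^ l))
            (ENNReal.ofReal s) unitLaw
        ≤ 8 * θ ^ l * (B * (k + 1) * θ ^ k) +
          8 * B * (l + 1) * ((k + 1 : ℕ) + l + 1) * θ ^ (k + 1 + l) := by
          gcongr
          · exact havg k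
          · exact ih (k + 1)
      _ ≤ 8 * B * (k + l + 2) * θ ^ (k + 1 + l) +
          8 * B * (l + 1) * (k + l + 2) * θ ^ (k + 1 + l) := by
          gcongr ?_ + ?_
          · calc 8 * θ ^ l * (B * (k + 1) * θ ^ k) = 8 * B * (k + 1) * θ ^ (k + l) := by
                  rw [pow_add]; ring
              _ ≤ _ := by
                  have e : (k : ENNReal) + l + 2 = k + 1 + (l + 1) := by ring
                  have h1 : (k : ENNReal) + 1 ≤ k + l + 2 := by rw [e]; exact le_self_add
                  have h2 : θ ^ (k + l) ≤ θ ^ (k + 1 + l) := pow_le_pow_right₀ hθ (by omega)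
                  exact mul_le_mul' (mul_le_mul' le_rfl h1) h2
          · refine le_of_eq ?_
            push_cast; ring
      _ = _ := by
          push_cast
          rw [show k + 1 + l = k + (l + 1) by ring]
          ring

lemma eLpNorm_orbitSum_two_pow_le {s : ℝ} (hs1 : 1 ≤ s) (hs2 : s ≤ 2) {f : ℝ → ℝ}
    (hf : Measurable f) {B : ENNReal} (hBt : B ≠ ⊤)
    (hB : eLpNorm f (ENNReal.ofReal s) unitLaw ≤ B)
    (hdec : ∀ k : ℕ, 2 ^ k * eLpNorm (branchAverage (2 ^ 2 ^ k) f) (ENNReal.ofReal s) unitLaw ≤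
      B * ((2 : ENNReal) ^ (1 / s)) ^ k) (l : ℕ) :
    eLpNorm (orbitSum f 2 (2 ^ l)) (ENNReal.ofReal s) unitLaw ≤
      8 * B * (l + 1) ^ 2 * ((2 : ENNReal) ^ (1 / s)) ^ l := by
  have h := eLpNorm_orbitSum_averageSum_le hs1 hs2 hf hBt hB hdec l 0
  have e : averageSum f 0 = f := by simp [averageSum, branchAverage_one]
  rw [e] at h
  refine h.trans (le_of_eq ?_)
  simp only [CharP.cast_eq_zero, zero_add]
  ring

/-! ### From blocks to maxima -/

/-- Dyadic chaining: every initial segment is a union of at most one dyadic block of each size. -/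
lemma abs_sum_range_lt_of_blocks {c : ℝ} (hc : 0 < c) (L : ℕ) (x : ℕ → ℝ)
    (h : ∀ l ≤ L, ∀ i < 2 ^ (L - l), |∑ j ∈ Finset.range (2 ^ l), x (i * 2 ^ l + j)| < c) :
    ∀ k ≤ 2 ^ L, |∑ j ∈ Finset.range k, x j| < (L + 1) * c := by
  induction L generalizing x with
  | zero =>
    intro k hk
    have h0 := h 0 le_rfl 0 (by simp)
    obtain rfl | rfl : k = 0 ∨ k = 1 := by simp at hk; omega
    · simpa using hc
    · simpa using h0
  | succ L ih =>
    intro k hk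
    push_cast
    rcases le_or_gt k (2 ^ L) with hkL | hkL
    · have := ih x (fun l hl i hi => h l (by omega) i
        (hi.trans_le (Nat.pow_le_pow_right (by norm_num) (by omega)))) k hkL
      linarith
    · obtain ⟨m, rfl⟩ := Nat.exists_eq_add_of_le hkL.le
      have h1 : |∑ j ∈ Finset.range (2 ^ L), x j| < c := by
        simpa using h L (by omega) 0 (by positivity)
      have h2 := ih (fun j => x (2 ^ L + j)) (fun l hl i hi => by
        have hp : 2 ^ L = 2 ^ (L - l) * 2 ^ l := by rw [← pow_add]; congr 1; omega
        have := h l (by omega) (2 ^ (L - l) + i) (by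
          rw [Nat.succ_sub hl, pow_succ]; omega)
        rw [add_mul, ← hp] at this
        simpa only [add_assoc] using this) m (by rw [pow_succ] at hk; omega)
      rw [Finset.sum_range_add]
      have := abs_add_le (∑ j ∈ Finset.range (2 ^ L), x j) (∑ j ∈ Finset.range m, x (2 ^ L + j))
      linarith

/-- Markov's inequality for dyadic blocks. -/
lemma exists_measureReal_orbitSum_le {s : ℝ} (hs1 : 1 ≤ s) (hs2 : s ≤ 2) {f : ℝ → ℝ}
    (hf : Measurable f) {B : ENNReal} (hBt : B ≠ ⊤)
    (hB : ∀ l : ℕ, eLpNorm (orbitSum f 2 (2 ^ l)) (ENNReal.ofReal s) unitLaw ≤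
      B * (l + 1) ^ 2 * ((2 : ENNReal) ^ (1 / s)) ^ l) :
    ∃ K : ℝ, 0 ≤ K ∧ ∀ (l : ℕ) (c : ℝ), 0 < c →
      unitLaw.real {x | c ≤ |orbitSum f 2 (2 ^ l) x|} ≤ K * (l + 1) ^ 4 * 2 ^ l / c ^ s := by
  have hs0 : 0 < s := by linarith
  refine ⟨(B ^ s).toReal, ENNReal.toReal_nonneg, fun l c hc => ?_⟩
  have hBs : B ^ s ≠ ⊤ := ENNReal.rpow_ne_top_of_nonneg hs0.le hBt
  have hset : {x | c ≤ |orbitSum f 2 (2 ^ l) x|} =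
      {x | ENNReal.ofReal c ≤ ‖orbitSum f 2 (2 ^ l) x‖ₑ} := by
    ext x
    rw [Set.mem_ofPred_eq, Set.mem_ofPred_eq, ← ofReal_norm, Real.norm_eq_abs,
      ENNReal.ofReal_le_ofReal_iff (abs_nonneg _)]
  have hmark := mul_meas_ge_le_pow_eLpNorm' unitLaw (p := ENNReal.ofReal s)
    (by simpa using hs0) (by simp)
    (measurable_orbitSum hf 2 (2 ^ l)).aestronglyMeasurable (ENNReal.ofReal c)
  rw [ENNReal.toReal_ofReal hs0.le, ← hset] at hmark
  have hpow : (B * (l + 1) ^ 2 * ((2 : ENNReal) ^ (1 / s)) ^ l) ^ s ≤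
      B ^ s * (l + 1) ^ 4 * 2 ^ l := by
    rw [ENNReal.mul_rpow_of_nonneg _ _ hs0.le, ENNReal.mul_rpow_of_nonneg _ _ hs0.le]
    refine mul_le_mul' (mul_le_mul' le_rfl ?_) ?_
    · calc (((l : ENNReal) + 1) ^ 2) ^ s ≤ (((l : ENNReal) + 1) ^ 2) ^ (2 : ℝ) :=
            ENNReal.rpow_le_rpow_of_exponent_le (one_le_pow₀ le_add_self) hs2
        _ = _ := by rw [ENNReal.rpow_two, ← pow_mul]
    · refine le_of_eq ?_
      rw [← ENNReal.rpow_natCast, ← ENNReal.rpow_mul, ← ENNReal.rpow_mul, ← ENNReal.rpow_natCast]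
      congr 1
      field_simp
  have hle : ENNReal.ofReal c ^ s * unitLaw {x | c ≤ |orbitSum f 2 (2 ^ l) x|} ≤
      B ^ s * (l + 1) ^ 4 * 2 ^ l :=
    hmark.trans ((ENNReal.rpow_le_rpow (hB l) hs0.le).trans hpow)
  have hfin : B ^ s * ((l : ENNReal) + 1) ^ 4 * 2 ^ l ≠ ⊤ := by
    refine ENNReal.mul_ne_top (ENNReal.mul_ne_top hBs (ENNReal.pow_ne_top ?_))
      (ENNReal.pow_ne_top (by simp))
    exact_mod_cast ENNReal.natCast_ne_top (l + 1)
  have hreal := ENNReal.toReal_mono hfin hle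
  rw [ENNReal.ofReal_rpow_of_pos hc, ENNReal.toReal_mul, ENNReal.toReal_ofReal (by positivity),
    ENNReal.toReal_mul, ENNReal.toReal_mul, ENNReal.toReal_pow, ENNReal.toReal_pow,
    ENNReal.toReal_add (by simp) (by simp)] at hreal
  rw [le_div_iff₀ (by positivity), mul_comm]
  simpa [Measure.real] using hreal

section Chain

variable {Ω : Type*} [MeasurableSpace Ω] {μ : Measure Ω} {X : ℕ → Ω → ℝ}

/-- Read backwards, a chain of dyadic points is an orbit of the doubling map. -/
lemma ae_eq_mulMod (hX : ∀ n, MeasurePreserving (X n) μ unitLaw)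
    (hback : ∀ n, ∀ᵐ ω ∂μ, mulMod 2 (X (n + 1) ω) = X n ω) (n j : ℕ) :
    ∀ᵐ ω ∂μ, X n ω = mulMod (2 ^ j) (X (n + j) ω) := by
  induction j with
  | zero =>
    filter_upwards [(hX n).quasiMeasurePreserving.ae ae_unitLaw_mem] with ω hω
    rw [pow_zero, add_zero, mulMod_one hω]
  | succ j ih =>
    filter_upwards [ih, hback (n + j)] with ω h1 h2
    rw [h1, ← h2, mulMod_mulMod, pow_succ, add_assoc]

lemma ae_sum_block_eq_orbitSum (hX : ∀ n, MeasurePreserving (X n) μ unitLaw)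
    (hback : ∀ n, ∀ᵐ ω ∂μ, mulMod 2 (X (n + 1) ω) = X n ω) (f : ℝ → ℝ) (a n : ℕ) :
    ∀ᵐ ω ∂μ, ∑ j ∈ Finset.range (n + 1), f (X (a + j) ω) = orbitSum f 2 (n + 1) (X (a + n) ω) := by
  have h := ae_all_iff.2 fun i => ae_all_iff.2 fun j => ae_eq_mulMod hX hback i j
  filter_upwards [h] with ω hω
  rw [orbitSum, ← Finset.sum_range_reflect]
  refine Finset.sum_congr rfl fun j hj => ?_
  have hj' := Finset.mem_range.1 hj
  rw [hω (a + (n + 1 - 1 - j)) j, show a + (n + 1 - 1 - j) + j = a + n by omega]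

/-- The maximal inequality, up to logarithms. Of the seven factors `L + 1`, four come from the
moments of the blocks, two from splitting the level `a` among the `L + 1` block sizes, and one from
the union bound over these sizes. -/
lemma measureReal_exists_le_abs_sum_le [IsFiniteMeasure μ]
    (hX : ∀ n, MeasurePreserving (X n) μ unitLaw)
    (hback : ∀ n, ∀ᵐ ω ∂μ, mulMod 2 (X (n + 1) ω) = X n ω) {f : ℝ → ℝ} (hf : Measurable f)
    {s K : ℝ} (hs2 : s ≤ 2) (hK : 0 ≤ K)
    (hblock : ∀ (l : ℕ) (c : ℝ), 0 < c →
      unitLaw.real {x | c ≤ |orbitSum f 2 (2 ^ l) x|} ≤ K * (l + 1) ^ 4 * 2 ^ l / c ^ s)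
    {n L : ℕ} (hn : n ≤ 2 ^ L) {a : ℝ} (ha : 0 < a) :
    μ.real {ω | ∃ k : ℕ, 1 ≤ k ∧ k ≤ n ∧ a ≤ |∑ j ∈ Finset.range k, f (X j ω)|} ≤
      K * (L + 1) ^ 7 * 2 ^ L / a ^ s := by
  have hL : (0 : ℝ) < L + 1 := by positivity
  set c := a / (L + 1) with hc_def
  have hc : 0 < c := by positivity
  set E : ℕ → ℕ → Set Ω := fun l i =>
    {ω | c ≤ |∑ j ∈ Finset.range (2 ^ l), f (X (i * 2 ^ l + j) ω)|} with hE
  have hsub : {ω | ∃ k : ℕ, 1 ≤ k ∧ k ≤ n ∧ a ≤ |∑ j ∈ Finset.range k, f (X j ω)|} ⊆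
      ⋃ l ∈ Finset.range (L + 1), ⋃ i ∈ Finset.range (2 ^ (L - l)), E l i := by
    rintro ω ⟨k, -, hkn, hk⟩
    by_contra hω
    simp only [Set.mem_iUnion, not_exists, Finset.mem_range, hE, Set.mem_ofPred_eq, not_le] at hω
    have := abs_sum_range_lt_of_blocks hc L (fun j => f (X j ω))
      (fun l hl i hi => hω l (by omega) i hi) k (hkn.trans hn)
    rw [hc_def, mul_div_cancel₀ _ hL.ne'] at this
    linarith
  have hEl : ∀ l ∈ Finset.range (L + 1), ∀ i, μ.real (E l i) ≤ K * (L + 1) ^ 6 * 2 ^ l / a ^ s := by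
    intro l hl i
    have hl' : (l : ℝ) ≤ L := by exact_mod_cast Nat.lt_succ_iff.1 (Finset.mem_range.1 hl)
    obtain ⟨m, hm⟩ : ∃ m, 2 ^ l = m + 1 := ⟨2 ^ l - 1, by have := Nat.one_le_two_pow (n := l); omega⟩
    have hmeas : MeasurableSet {x | c ≤ |orbitSum f 2 (2 ^ l) x|} :=
      measurableSet_le measurable_const (by fun_prop)
    have e : μ.real (E l i) = unitLaw.real {x | c ≤ |orbitSum f 2 (2 ^ l) x|} := by
      rw [← (hX (i * 2 ^ l + m)).measureReal_preimage hmeas.nullMeasurableSet]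
      refine measureReal_congr ?_
      filter_upwards [ae_sum_block_eq_orbitSum hX hback f (i * 2 ^ l) m] with ω hω
      rw [← hm] at hω
      exact propext (by
        change c ≤ |∑ j ∈ Finset.range (2 ^ l), f (X (i * 2 ^ l + j) ω)| ↔ _
        rw [hω]; rfl)
    have hcs : (a / (L + 1)) ^ s ≥ a ^ s / (L + 1) ^ 2 := by
      rw [Real.div_rpow ha.le hL.le]
      gcongr
      rw [← Real.rpow_two]
      exact Real.rpow_le_rpow_of_exponent_le (by linarith [(Nat.cast_nonneg L : (0 : ℝ) ≤ L)]) hs2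
    rw [e]
    calc _ ≤ K * (l + 1) ^ 4 * 2 ^ l / c ^ s := hblock l c hc
      _ ≤ K * (L + 1) ^ 4 * 2 ^ l / (a ^ s / (L + 1) ^ 2) := by
          have : 0 < a ^ s / (L + 1 : ℝ) ^ 2 := by positivity
          gcongr
      _ = _ := by field_simp
  calc _ ≤ μ.real (⋃ l ∈ Finset.range (L + 1), ⋃ i ∈ Finset.range (2 ^ (L - l)), E l i) :=
        measureReal_mono hsub (measure_ne_top _ _)
    _ ≤ ∑ l ∈ Finset.range (L + 1), μ.real (⋃ i ∈ Finset.range (2 ^ (L - l)), E l i) :=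
        measureReal_biUnion_finset_le _ _
    _ ≤ ∑ l ∈ Finset.range (L + 1), ∑ i ∈ Finset.range (2 ^ (L - l)), μ.real (E l i) :=
        Finset.sum_le_sum fun l _ => measureReal_biUnion_finset_le _ _
    _ ≤ ∑ l ∈ Finset.range (L + 1), ∑ i ∈ Finset.range (2 ^ (L - l)),
          K * (L + 1) ^ 6 * 2 ^ l / a ^ s :=
        Finset.sum_le_sum fun l hl => Finset.sum_le_sum fun i _ => hEl l hl i
    _ = ∑ l ∈ Finset.range (L + 1), K * (L + 1) ^ 6 * 2 ^ L / a ^ s := by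
        refine Finset.sum_congr rfl fun l hl => ?_
        rw [Finset.sum_const, Finset.card_range, nsmul_eq_mul]
        have : (2 : ℝ) ^ L = 2 ^ (L - l) * 2 ^ l := by
          rw [← pow_add]; congr 1; have := Finset.mem_range.1 hl; omega
        rw [this]; push_cast; ring
    _ = _ := by
        rw [Finset.sum_const, Finset.card_range, nsmul_eq_mul]; push_cast; ring

end Chain

/-! ### Summation over `n` -/

lemma exists_log_add_two_pow_le {η : ℝ} (hη : 0 < η) :
    ∃ D : ℝ, 0 ≤ D ∧ ∀ n : ℕ, 1 ≤ n → ((Nat.log 2 n : ℝ) + 2) ^ 7 ≤ D * (n : ℝ) ^ η := by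
  have hl2 := Real.log_pos (by norm_num : (1 : ℝ) < 2)
  refine ⟨(7 / (η * Real.log 2) + 2) ^ 7, by positivity, fun n hn => ?_⟩
  have hn' : (1 : ℝ) ≤ n := by exact_mod_cast hn
  have h1 : (Nat.log 2 n : ℝ) * Real.log 2 ≤ Real.log n := by
    rw [← Real.log_pow]
    refine Real.log_le_log (by positivity) ?_
    exact_mod_cast Nat.pow_log_le_self 2 (by omega)
  have h2 : Real.log n ≤ (n : ℝ) ^ (η / 7) / (η / 7) :=
    Real.log_le_rpow_div (by positivity) (by positivity)
  have h3 : (1 : ℝ) ≤ (n : ℝ) ^ (η / 7) := Real.one_le_rpow hn' (by positivity)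
  have h4 : (Nat.log 2 n : ℝ) + 2 ≤ (7 / (η * Real.log 2) + 2) * (n : ℝ) ^ (η / 7) := by
    have : (Nat.log 2 n : ℝ) ≤ 7 / (η * Real.log 2) * (n : ℝ) ^ (η / 7) := by
      rw [div_mul_eq_mul_div, le_div_iff₀ (by positivity)]
      rw [le_div_iff₀ (by positivity)] at h2
      nlinarith
    linarith
  calc ((Nat.log 2 n : ℝ) + 2) ^ 7 ≤ ((7 / (η * Real.log 2) + 2) * (n : ℝ) ^ (η / 7)) ^ 7 := by
        gcongr
    _ = _ := by
        rw [mul_pow, ← Real.rpow_natCast ((n : ℝ) ^ (η / 7)), ← Real.rpow_mul (by positivity)]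
        congr 2; push_cast; ring

/-- A maximal inequality of order `n / a ^ s` up to logarithms, for some `s > p`, makes the series
of the `p`-strong law converge. -/
lemma summable_of_tail_le {p s α ε K : ℝ} (hp : 0 < p) (hps : p < s) (hα : 1 / p ≤ α)
    (hε : 0 < ε) {T : ℕ → ℝ} (hT0 : ∀ n, 0 ≤ T n)
    (hT : ∀ n L : ℕ, 1 ≤ n → n ≤ 2 ^ L →
      T n ≤ K * (L + 1) ^ 7 * 2 ^ L / (ε * (n : ℝ) ^ α) ^ s) (hK : 0 ≤ K) :
    Summable fun n : ℕ => (n : ℝ) ^ (α * p - 2) * T n := by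
  have hα0 : 0 < α := lt_of_lt_of_le (by positivity) hα
  set γ := α * (s - p) with hγ
  have hγ0 : 0 < γ := mul_pos hα0 (by linarith)
  obtain ⟨D, hD0, hD⟩ := exists_log_add_two_pow_le (η := γ / 2) (by positivity)
  have hsum : Summable fun n : ℕ => (2 * K * D / ε ^ s) * (n : ℝ) ^ (-1 - γ / 2) :=
    (Real.summable_nat_rpow.2 (by linarith)).mul_left _
  refine (summable_nat_add_iff 1).1 (Summable.of_nonneg_of_le
    (fun n => mul_nonneg (by positivity) (hT0 _)) (fun n => ?_) ((summable_nat_add_iff 1).2 hsum))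
  obtain ⟨m, hm⟩ : ∃ m, m = n + 1 := ⟨_, rfl⟩
  rw [← hm]
  have hm1 : 1 ≤ m := by omega
  have hm0 : (0 : ℝ) < m := by exact_mod_cast hm1
  have h1 := hT m (Nat.log 2 m + 1) hm1 (Nat.lt_pow_succ_log_self (by norm_num) m).le
  have h2 : (2 : ℝ) ^ (Nat.log 2 m + 1) ≤ 2 * m := by
    rw [pow_succ, mul_comm]
    gcongr
    exact_mod_cast Nat.pow_log_le_self 2 (by omega)
  have h3 : (((Nat.log 2 m + 1 : ℕ) : ℝ) + 1) ^ 7 ≤ D * (m : ℝ) ^ (γ / 2) := by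
    refine le_trans (le_of_eq ?_) (hD m hm1)
    push_cast; ring
  calc (m : ℝ) ^ (α * p - 2) * T m
      ≤ (m : ℝ) ^ (α * p - 2) *
        (K * (D * (m : ℝ) ^ (γ / 2)) * (2 * m) / (ε * (m : ℝ) ^ α) ^ s) := by
        gcongr
        refine h1.trans ?_
        gcongr
    _ = (2 * K * D / ε ^ s) * ((m : ℝ) ^ (α * p - 2) * (m : ℝ) ^ (γ / 2) * (m : ℝ) ^ (1 : ℝ) *
          (m : ℝ) ^ (-(α * s))) := by
        rw [Real.mul_rpow hε.le (by positivity), ← Real.rpow_mul hm0.le, Real.rpow_neg hm0.le,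
          Real.rpow_one]
        field_simp
    _ = _ := by
        rw [← Real.rpow_add hm0, ← Real.rpow_add hm0, ← Real.rpow_add hm0]
        congr 2
        rw [hγ]; ring

/-! ### The law of the dyadic point -/

lemma abs_branchAverage_sub_le {φ : ℝ → ℝ} {c : ℝ} (hφ : ∀ x y, |φ x - φ y| ≤ c * |x - y|)
    {N : ℕ} (hN : 0 < N) (x y : ℝ) :
    |branchAverage N φ x - branchAverage N φ y| ≤ c * |x - y| / N := by
  have hN' : (0 : ℝ) < N := by exact_mod_cast hN
  simp only [branchAverage, ← mul_sub, ← Finset.sum_sub_distrib]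
  rw [abs_mul, abs_of_pos (inv_pos.2 hN'), inv_mul_le_iff₀ hN']
  refine (Finset.abs_sum_le_sum_abs _ _).trans ?_
  calc _ ≤ ∑ j ∈ Finset.range N, c * |x - y| / N := by
        refine Finset.sum_le_sum fun j _ => (hφ _ _).trans (le_of_eq ?_)
        rw [← sub_div, add_sub_add_right_eq_sub, abs_div, abs_of_pos hN', mul_div_assoc]
    _ = _ := by simp

lemma abs_branchAverage_le {φ : ℝ → ℝ} {C : ℝ} (hφ : ∀ x, |φ x| ≤ C) {N : ℕ} (hN : 0 < N) (x : ℝ) :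
    |branchAverage N φ x| ≤ C := by
  have hN' : (0 : ℝ) < N := by exact_mod_cast hN
  rw [branchAverage, abs_mul, abs_of_pos (inv_pos.2 hN'), inv_mul_le_iff₀ hN']
  refine (Finset.abs_sum_le_sum_abs _ _).trans ((Finset.sum_le_sum fun j _ => hφ _).trans ?_)
  simp

/-- Lebesgue measure is the only probability measure on the unit interval that is the mean of its
images under `x ↦ x / 2` and `x ↦ (x + 1) / 2`, since iterated averages of a Lipschitz function
become constant. -/
lemma eq_unitLaw_of_integral_branchAverage {ν : Measure ℝ} [IsProbabilityMeasure ν]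
    (hν : ∀ᵐ x ∂ν, x ∈ Set.Icc (0 : ℝ) 1)
    (hinv : ∀ φ : ℝ → ℝ, Measurable φ → (∃ C, ∀ x, |φ x| ≤ C) →
      ∫ x, φ x ∂ν = ∫ x, branchAverage 2 φ x ∂ν) : ν = unitLaw := by
  have hint : ∀ (ρ : Measure ℝ) [IsProbabilityMeasure ρ] (φ : ℝ → ℝ), Measurable φ →
      (∀ x, |φ x| ≤ 1) → Integrable φ ρ := fun ρ _ φ hφ hb =>
    Integrable.of_bound hφ.aestronglyMeasurable 1 (Filter.Eventually.of_forall hb)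
  have hnear : ∀ (ρ : Measure ℝ) [IsProbabilityMeasure ρ], (∀ᵐ x ∂ρ, x ∈ Set.Icc (0 : ℝ) 1) →
      ∀ (φ : ℝ → ℝ) (c : ℝ), Measurable φ → (∀ x, |φ x| ≤ 1) → 0 ≤ c →
      (∀ x y, |φ x - φ y| ≤ c * |x - y|) → ∀ n : ℕ,
      |∫ x, branchAverage (2 ^ n) φ x ∂ρ - branchAverage (2 ^ n) φ 0| ≤ c / 2 ^ n := by
    intro ρ _ hρ φ c hφ hb hc hl n
    have hi : Integrable (branchAverage (2 ^ n) φ) ρ :=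
      hint ρ _ (by fun_prop) (abs_branchAverage_le hb (by positivity))
    have e : ∫ x, branchAverage (2 ^ n) φ x ∂ρ - branchAverage (2 ^ n) φ 0 =
        ∫ x, (branchAverage (2 ^ n) φ x - branchAverage (2 ^ n) φ 0) ∂ρ := by
      rw [integral_sub hi (integrable_const _)]; simp
    rw [e]
    have hd : ∀ᵐ x ∂ρ, ‖branchAverage (2 ^ n) φ x - branchAverage (2 ^ n) φ 0‖ ≤ c / 2 ^ n := ?_
    · exact (norm_integral_le_of_norm_le_const hd).trans_eq (by rw [probReal_univ, mul_one])
    filter_upwards [hρ] with x hx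
    refine (abs_branchAverage_sub_le hl (by positivity) x 0).trans ?_
    push_cast
    gcongr
    rw [sub_zero, abs_of_nonneg hx.1]
    exact mul_le_of_le_one_right hc hx.2
  have hiter : ∀ (φ : ℝ → ℝ), Measurable φ → (∀ x, |φ x| ≤ 1) → ∀ n : ℕ,
      ∫ x, φ x ∂ν = ∫ x, branchAverage (2 ^ n) φ x ∂ν := by
    intro φ hφ hb n
    induction n with
    | zero => simp [branchAverage_one]
    | succ n ih =>
      rw [ih, hinv _ (by fun_prop) ⟨1, abs_branchAverage_le hb (by positivity)⟩,
        branchAverage_branchAverage (by norm_num) (by positivity), ← pow_succ']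
  have hunit : ∀ᵐ x ∂unitLaw, x ∈ Set.Icc (0 : ℝ) 1 :=
    ae_unitLaw_mem.mono fun x hx => Set.Ico_subset_Icc_self hx
  have heq : ∀ (φ : ℝ → ℝ) (c : ℝ), Measurable φ → (∀ x, |φ x| ≤ 1) → 0 ≤ c →
      (∀ x y, |φ x - φ y| ≤ c * |x - y|) → ∫ x, φ x ∂ν = ∫ x, φ x ∂unitLaw := by
    intro φ c hφ hb hc hl
    have hle : ∀ n : ℕ, |∫ x, φ x ∂ν - ∫ x, φ x ∂unitLaw| ≤ 2 * c * (1 / 2) ^ n := by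
      intro n
      rw [hiter φ hφ hb n, ← integral_branchAverage (N := 2 ^ n) (by positivity) hφ
        (hint unitLaw φ hφ hb)]
      have h1 := abs_le.1 (hnear ν hν φ c hφ hb hc hl n)
      have h2 := abs_le.1 (hnear unitLaw hunit φ c hφ hb hc hl n)
      have e : 2 * c * (1 / 2) ^ n = 2 * (c / 2 ^ n) := by
        rw [div_pow, one_pow]; ring
      rw [e, abs_le]
      constructor <;> linarith [h1.1, h1.2, h2.1, h2.2]
    have ht : Filter.Tendsto (fun n : ℕ => 2 * c * (1 / 2 : ℝ) ^ n) Filter.atTop (nhds 0) := by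
      simpa using (tendsto_pow_atTop_nhds_zero_of_lt_one (by norm_num : (0 : ℝ) ≤ 1 / 2)
        (by norm_num)).const_mul (2 * c)
    have := ge_of_tendsto' ht hle
    exact sub_eq_zero.1 (abs_nonpos_iff.1 this)
  have hcos : ∀ t : ℝ, ∫ x, Real.cos (t * x) ∂ν = ∫ x, Real.cos (t * x) ∂unitLaw := fun t =>
    heq _ |t| (by fun_prop) (fun x => Real.abs_cos_le_one _) (abs_nonneg _) fun x y =>
      (Real.abs_cos_sub_cos_le _ _).trans_eq (by rw [← mul_sub, abs_mul])
  have hsin : ∀ t : ℝ, ∫ x, Real.sin (t * x) ∂ν = ∫ x, Real.sin (t * x) ∂unitLaw := fun t =>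
    heq _ |t| (by fun_prop) (fun x => Real.abs_sin_le_one _) (abs_nonneg _) fun x y =>
      (Real.abs_sin_sub_sin_le _ _).trans_eq (by rw [← mul_sub, abs_mul])
  have hchar : ∀ (ρ : Measure ℝ) [IsProbabilityMeasure ρ] (t : ℝ), charFun ρ t =
      ((∫ x, Real.cos (t * x) ∂ρ : ℝ) : ℂ) + ((∫ x, Real.sin (t * x) ∂ρ : ℝ) : ℂ) * Complex.I := by
    intro ρ _ t
    rw [charFun_apply_real, ← integral_complex_ofReal, ← integral_complex_ofReal, ← integral_mul_const,
      ← integral_add]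
    · refine integral_congr_ae (Filter.Eventually.of_forall fun x => ?_)
      simp only
      rw [← Complex.ofReal_mul, Complex.exp_mul_I, Complex.ofReal_cos, Complex.ofReal_sin]
    · exact (hint ρ _ (by fun_prop) fun x => Real.abs_cos_le_one _).ofReal
    · exact (hint ρ _ (by fun_prop) fun x => Real.abs_sin_le_one _).ofReal.mul_const _
  refine Measure.ext_of_charFun (funext fun t => ?_)
  rw [hchar, hchar, hcos, hsin]

instance : IsProbabilityMeasure coinMeasure := by
  unfold coinMeasure; infer_instance

lemma measurePreserving_coinShift : MeasurePreserving coinShift coinMeasure coinMeasure :=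
  ⟨by unfold coinShift; fun_prop, Measure.map_infinitePi_infinitePi_of_inj
    (P := fun _ : ℤ => (PMF.uniformOfFintype (Fin 2)).toMeasure) (add_left_injective (1 : ℤ))⟩

lemma digit_le_one (ω : CoinSpace) (k : ℤ) : ((ω k : ℕ) : ℝ) ≤ 1 := by
  exact_mod_cast Nat.lt_succ_iff.1 (ω k).isLt

lemma summable_one_div_two_pow_succ : Summable fun k : ℕ => (1 : ℝ) / 2 ^ (k + 1) := by
  have h : Summable fun k : ℕ => (1 / 2 : ℝ) ^ k := summable_geometric_two
  simpa [one_div, inv_pow] using (summable_nat_add_iff 1).2 h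

lemma summable_dyadicPoint (ω : CoinSpace) :
    Summable fun k : ℕ => ((ω (-(k : ℤ)) : ℕ) : ℝ) / 2 ^ (k + 1) :=
  Summable.of_nonneg_of_le (fun k => by positivity)
    (fun k => by gcongr; exact digit_le_one ω _) summable_one_div_two_pow_succ

lemma dyadicPoint_mem (ω : CoinSpace) : dyadicPoint ω ∈ Set.Icc (0 : ℝ) 1 := by
  refine ⟨tsum_nonneg fun k => by positivity, ?_⟩
  calc dyadicPoint ω ≤ ∑' k : ℕ, (1 : ℝ) / 2 ^ (k + 1) :=
        (summable_dyadicPoint ω).tsum_le_tsum (fun k => by gcongr; exact digit_le_one ω _)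
          summable_one_div_two_pow_succ
    _ = 1 := by
        have h := tsum_geometric_two
        rw [summable_geometric_two.tsum_eq_zero_add] at h
        simp only [one_div, inv_pow, pow_zero] at h ⊢
        linarith

/-- The dyadic points form a Markov chain: a new digit is put in front. -/
lemma dyadicPoint_coinShift (ω : CoinSpace) :
    dyadicPoint (coinShift ω) = (dyadicPoint ω + (ω 1 : ℕ)) / 2 := by
  rw [dyadicPoint, (summable_dyadicPoint _).tsum_eq_zero_add, dyadicPoint, add_div,
    ← tsum_div_const, add_comm]
  congr 1
  · refine tsum_congr fun k => ?_
    rw [coinShift, div_div, ← pow_succ]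
    congr 4
    push_cast; ring
  · simp [coinShift]

lemma measurable_tsum_digits {α : Type*} {m : MeasurableSpace α} {d : ℕ → α → Fin 2}
    (hd : ∀ k, Measurable (d k)) :
    Measurable fun a => ∑' k : ℕ, ((d k a : ℕ) : ℝ) / 2 ^ (k + 1) :=
  Measurable.tsum fun k =>
    (measurable_of_countable (fun a : Fin 2 => ((a : ℕ) : ℝ) / 2 ^ (k + 1))).comp (hd k)

lemma indepFun_dyadicPoint_digit :
    ProbabilityTheory.IndepFun dyadicPoint (fun ω : CoinSpace => ω 1) coinMeasure := by
  have hind : ProbabilityTheory.iIndepFun (fun (i : ℤ) (ω : CoinSpace) => ω i) coinMeasure :=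
    ProbabilityTheory.iIndepFun_infinitePi (X := fun _ x => x) (fun _ => measurable_id)
  have h := ProbabilityTheory.indep_iSup_of_disjoint
    (m := fun i : ℤ => MeasurableSpace.comap (fun ω : CoinSpace => ω i) inferInstance)
    (fun i => (measurable_pi_apply i).comap_le) hind
    (S := Set.Iic 0) (T := {1}) (by simp)
  refine ProbabilityTheory.indep_of_indep_of_le_left
    (ProbabilityTheory.indep_of_indep_of_le_right h ?_) ?_
  · exact le_iSup₂_of_le 1 rfl le_rfl
  · refine Measurable.comap_le ?_
    exact measurable_tsum_digits fun k =>
      measurable_iff_comap_le.2 (le_iSup₂_of_le (-(k : ℤ)) (by simp) le_rfl)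

@[fun_prop]
lemma measurable_dyadicPoint : Measurable dyadicPoint :=
  measurable_tsum_digits fun _ => measurable_pi_apply _

/-- Under fair coin tossing the dyadic point is uniformly distributed. -/
lemma measurePreserving_dyadicPoint : MeasurePreserving dyadicPoint coinMeasure unitLaw := by
  refine ⟨measurable_dyadicPoint, ?_⟩
  have : IsProbabilityMeasure (coinMeasure.map dyadicPoint) :=
    Measure.isProbabilityMeasure_map measurable_dyadicPoint.aemeasurable
  refine eq_unitLaw_of_integral_branchAverage ?_ fun φ hφ ⟨C, hC⟩ => ?_
  · exact (ae_map_iff (p := fun x => x ∈ Set.Icc (0 : ℝ) 1) measurable_dyadicPoint.aemeasurable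
      measurableSet_Icc).2 (Filter.Eventually.of_forall dyadicPoint_mem)
  have hcoin : coinMeasure.map (fun ω : CoinSpace => ω 1) =
      (PMF.uniformOfFintype (Fin 2)).toMeasure := Measure.infinitePi_map_eval _ _
  have hg : Measurable fun z : ℝ × Fin 2 => φ ((z.1 + (z.2 : ℕ)) / 2) := by
    have : Measurable fun z : ℝ × Fin 2 => ((z.2 : ℕ) : ℝ) :=
      (measurable_of_countable (fun a : Fin 2 => ((a : ℕ) : ℝ))).comp measurable_snd
    fun_prop
  have hpair : Measurable fun ω : CoinSpace => (dyadicPoint ω, ω 1) := by fun_prop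
  have hprod := (ProbabilityTheory.indepFun_iff_map_prod_eq_prod_map_map
    measurable_dyadicPoint.aemeasurable (measurable_pi_apply _).aemeasurable).1
    indepFun_dyadicPoint_digit
  have hfin : ∀ x : ℝ, ∫ e : Fin 2, φ ((x + (e : ℕ)) / 2)
      ∂(PMF.uniformOfFintype (Fin 2)).toMeasure = branchAverage 2 φ x := by
    intro x
    rw [PMF.integral_eq_sum]
    simp [branchAverage, Fin.sum_univ_two, Finset.sum_range_succ]
    ring
  have e1 : ∫ x, φ x ∂coinMeasure.map dyadicPoint = ∫ ω, φ (dyadicPoint ω) ∂coinMeasure :=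
    integral_map measurable_dyadicPoint.aemeasurable hφ.aestronglyMeasurable
  have e2 : ∫ ω, φ (dyadicPoint ω) ∂coinMeasure =
      ∫ ω, φ (dyadicPoint (coinShift ω)) ∂coinMeasure := by
    have hm : Measurable fun ω => φ (dyadicPoint ω) := by fun_prop
    have := integral_map (μ := coinMeasure) measurePreserving_coinShift.measurable.aemeasurable
      hm.aestronglyMeasurable
    rwa [measurePreserving_coinShift.map_eq] at this
  have e3 : ∫ ω, φ (dyadicPoint (coinShift ω)) ∂coinMeasure =
      ∫ z : ℝ × Fin 2, φ ((z.1 + (z.2 : ℕ)) / 2)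
        ∂coinMeasure.map (fun ω : CoinSpace => (dyadicPoint ω, ω 1)) := by
    rw [integral_map hpair.aemeasurable hg.aestronglyMeasurable]
    simp only [dyadicPoint_coinShift]
  rw [e1, e2, e3, hprod, hcoin, integral_prod]
  · exact integral_congr_ae (Filter.Eventually.of_forall hfin)
  · exact Integrable.of_bound hg.aestronglyMeasurable C
      (Filter.Eventually.of_forall fun z => hC _)

lemma measurePreserving_dyadicPoint_iterate (n : ℕ) :
    MeasurePreserving (fun ω => dyadicPoint (coinShift^[n] ω)) coinMeasure unitLaw :=
  measurePreserving_dyadicPoint.comp (measurePreserving_coinShift.iterate n)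

/-- The doubling map removes the newest digit. The exception is the dyadic point `1`, which has
probability zero. -/
lemma ae_mulMod_two_dyadicPoint_iterate (n : ℕ) : ∀ᵐ ω ∂coinMeasure,
    mulMod 2 (dyadicPoint (coinShift^[n + 1] ω)) = dyadicPoint (coinShift^[n] ω) := by
  filter_upwards [(measurePreserving_dyadicPoint_iterate n).quasiMeasurePreserving.ae
    ae_unitLaw_mem] with ω hω
  rw [Function.iterate_succ_apply', dyadicPoint_coinShift]
  exact_mod_cast mulMod_branch (N := 2) (by norm_num) (coinShift^[n] ω 1 : ℕ) hω

/-! ### The strong law -/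

/-- A polynomial rate for the averages over `4 ^ n` branches, read along `n = 2 ^ k`. -/
lemma exists_two_pow_mul_eLpNorm_le {s : ℝ} (hs1 : 1 ≤ s) {f : ℝ → ℝ} (hf : Measurable f)
    (hfs : eLpNorm f (ENNReal.ofReal s) unitLaw ≠ ⊤)
    (h : ∃ C : ENNReal, C ≠ ⊤ ∧ ∀ n : ℕ, 1 ≤ n →
      ∫⁻ x, ‖branchAverage (2 ^ (2 * n)) f x‖ₑ ^ s ∂unitLaw ≤ C * (n : ENNReal) ^ (-(s - 1))) :
    ∃ B : ENNReal, B ≠ ⊤ ∧ eLpNorm f (ENNReal.ofReal s) unitLaw ≤ B ∧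
      ∀ k : ℕ, 2 ^ k * eLpNorm (branchAverage (2 ^ 2 ^ k) f) (ENNReal.ofReal s) unitLaw ≤
        B * ((2 : ENNReal) ^ (1 / s)) ^ k := by
  obtain ⟨C, hC, h⟩ := h
  have hs0 : 0 < s := by linarith
  have hθ : (1 : ENNReal) ≤ 2 ^ (1 / s) := ENNReal.one_le_rpow (by norm_num) (by positivity)
  have hCs : C ^ (1 / s) ≠ ⊤ := ENNReal.rpow_ne_top_of_nonneg (by positivity) hC
  refine ⟨eLpNorm f (ENNReal.ofReal s) unitLaw + 2 * C ^ (1 / s),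
    ENNReal.add_ne_top.2 ⟨hfs, ENNReal.mul_ne_top (by simp) hCs⟩, le_self_add, fun k => ?_⟩
  cases k with
  | zero =>
    simp only [pow_zero, one_mul, mul_one]
    exact (eLpNorm_branchAverage_le hs1 (by positivity) hf).trans le_self_add
  | succ k =>
    have h1 : eLpNorm (branchAverage (2 ^ 2 ^ (k + 1)) f) (ENNReal.ofReal s) unitLaw ≤
        C ^ (1 / s) * (2 : ENNReal) ^ (k * (-(s - 1) * (1 / s))) := by
      rw [eLpNorm_ofReal_eq hs0, pow_succ, mul_comm]
      refine (ENNReal.rpow_le_rpow (h (2 ^ k) Nat.one_le_two_pow) (by positivity)).trans_eq ?_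
      rw [ENNReal.mul_rpow_of_nonneg _ _ (by positivity), ← ENNReal.rpow_mul, Nat.cast_pow,
        Nat.cast_ofNat, ← ENNReal.rpow_natCast, ← ENNReal.rpow_mul]
    have h2 : (2 : ENNReal) ^ k * (2 : ENNReal) ^ (k * (-(s - 1) * (1 / s))) =
        ((2 : ENNReal) ^ (1 / s)) ^ k := by
      rw [← ENNReal.rpow_natCast, ← ENNReal.rpow_natCast, ← ENNReal.rpow_mul,
        ← ENNReal.rpow_add _ _ (by simp) (by simp)]
      congr 1
      field_simp
      ring
    calc _ ≤ 2 ^ (k + 1) * (C ^ (1 / s) * (2 : ENNReal) ^ (k * (-(s - 1) * (1 / s)))) := by gcongr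
      _ = 2 * C ^ (1 / s) * (2 ^ k * (2 : ENNReal) ^ (k * (-(s - 1) * (1 / s)))) := by
          rw [pow_succ]; ring
      _ ≤ _ := by
          rw [h2]
          exact mul_le_mul' le_add_self (pow_le_pow_right₀ hθ k.le_succ)

/-- The exponent `s = p + δ (r - p) / (r + δ)`: slightly above `p`, so that the moment bound of
order `s` is summable, and close enough to `p` that interpolation between `L^q` and `L^r` still
gives the rate of decay `n ^ (-(s - 1))`. -/
lemma exists_interpolation_exponent {p r q δ : ℝ} (hp1 : 1 < p) (hpr : p < r) (hδ : 0 < δ)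
    (hq : (p - 1) * r / (r - 1) ≤ q) :
    ∃ s, p < s ∧ s < r ∧ (s - 1) * (r - q) ≤ (q + δ) * (r - s) := by
  have hr1 : 0 < r - 1 := by linarith
  have hrδ : 0 < r + δ := by linarith
  have hrp : 0 < r - p := by linarith
  rw [div_le_iff₀ hr1] at hq
  set η := δ * (r - p) / (r + δ) with hη
  have hη0 : 0 < η := by positivity
  have hηeq : η * (r + δ) = δ * (r - p) := by rw [hη]; field_simp
  refine ⟨p + η, by linarith, ?_, ?_⟩
  · nlinarith
  · nlinarith

theorem proposition2p13 (p r δ : ℝ) (hp1 : 1 < p) (hp2 : p < 2) (hpr : p < r) (hr2 : r < 2)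
    (hδ : 0 < δ) (f : ℝ → ℝ)
    (hfr : MemLp f (ENNReal.ofReal r) (volume.restrict (Set.Icc (0 : ℝ) 1)))
    (hf0 : ∫ x in Set.Icc (0 : ℝ) 1, f x = 0)
    (h₁ : LogWeightedIntegralFinite f (max 1 ((p - 1) * r / (r - 1))) δ)
    (h₂ : LogWeightedIntegralFinite (dyadicTilde f) r δ) :
    PStrongLaw coinMeasure coinShift p (fun ω => f (dyadicPoint ω)) := by
  rw [← unitLaw_eq_restrict_Icc] at hfr hf0
  set q := max 1 ((p - 1) * r / (r - 1)) with hq_def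
  have hq1 : 1 ≤ q := le_max_left _ _
  have hqp : q < p := by
    refine max_lt hp1 ((div_lt_iff₀ (by linarith)).2 ?_)
    nlinarith
  obtain ⟨s, hps, hsr, hκ⟩ :=
    exists_interpolation_exponent hp1 hpr hδ (le_max_right _ _)
  have hs1 : 1 ≤ s := by linarith
  have hs2 : s ≤ 2 := by linarith
  -- A Borel version of `f`; almost surely it agrees with `f` along the whole chain.
  obtain ⟨g, hgm, hfg⟩ : ∃ g : ℝ → ℝ, Measurable g ∧ f =ᵐ[unitLaw] g :=
    ⟨_, hfr.1.stronglyMeasurable_mk.measurable, hfr.1.ae_eq_mk⟩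
  have hgr : MemLp g (ENNReal.ofReal r) unitLaw := hfr.ae_eq hfg
  have hr1 : (1 : ENNReal) ≤ ENNReal.ofReal r := by
    simpa using ENNReal.ofReal_le_ofReal (by linarith : 1 ≤ r)
  have hg0 : ∫ x, g x ∂unitLaw = 0 := by rw [← hf0]; exact integral_congr_ae hfg.symm
  have hgr' : ∫⁻ x, ‖g x‖ₑ ^ r ∂unitLaw ≠ ⊤ := by
    rw [← ofReal_integral_abs_rpow (by linarith) hgr]
    exact ENNReal.ofReal_ne_top
  have hgs : MemLp g (ENNReal.ofReal s) unitLaw :=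
    hgr.mono_exponent (ENNReal.ofReal_le_ofReal hsr.le)
  have hdecay := exists_lintegral_branchAverage_interp_le hgm hq1 (hqp.trans hps) hsr hκ hgr'
    (exists_lintegral_branchAverage_le hgm (hgr.integrable hr1) hg0 hq1 hδ (h₁.congr_ae hfg))
  obtain ⟨B, hBt, hB, hdec⟩ := exists_two_pow_mul_eLpNorm_le hs1 hgm hgs.2.ne hdecay
  obtain ⟨K, hK0, hK⟩ := exists_measureReal_orbitSum_le hs1 hs2 hgm
    (ENNReal.mul_ne_top (by simp) hBt)
    (eLpNorm_orbitSum_two_pow_le hs1 hs2 hgm hBt hB hdec)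
  intro α hα _ ε hε
  refine summable_of_tail_le (by linarith) hps hα hε (fun n => measureReal_nonneg)
    (fun n L hn hnL => ?_) hK0
  have hae : ∀ᵐ ω ∂coinMeasure, ∀ j, f (dyadicPoint (coinShift^[j] ω)) =
      g (dyadicPoint (coinShift^[j] ω)) :=
    ae_all_iff.2 fun j => (measurePreserving_dyadicPoint_iterate j).quasiMeasurePreserving.ae hfg
  have hn0 : (0 : ℝ) < n := by exact_mod_cast hn
  refine le_trans (le_of_eq ?_) (measureReal_exists_le_abs_sum_le
    measurePreserving_dyadicPoint_iterate ae_mulMod_two_dyadicPoint_iterate hgm hs2 hK0 hK hnL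
    (a := ε * (n : ℝ) ^ α) (by positivity))
  refine measureReal_congr ?_
  filter_upwards [hae] with ω hω
  refine propext (exists_congr fun k => and_congr_right fun _ => and_congr_right fun _ => ?_)
  rw [birkhoffSum, Finset.sum_congr rfl fun j _ => hω j]
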